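/- Let $m\ge 1$ be an integer. There exist real numbers $\alpha,B,C>0$, depending only on $m$, such that the following holds. Let $V$ be a finite vector space over a field $k$, and let $H$ be any abelian group. An $m$-cube in $V$ is a tuple $c=(u\,|\,v_1,\dots,v_m)\in V\times V^m$, with vertices $c_\omega=u+\sum_{i=1}^m\omega_iv_i$ for $\omega\in\{0,1\}^m$; write $|\omega|=\sum_i\omega_i$. For $X\subseteq V$ let $C_m(X)$ be the set of $m$-cubes all of whose vertices lie in $X$, and for $f:X\to H$ and $c\in C_m(X)$ put $f_m(c)=\sum_{\omega\in\{0,1\}^m}(-1)^{|\omega|}f(c_\omega)\in H$. For $g:V\to\mathbb C$ define the Gowers norm by $$\|g\|_{U_m}^{2^m}=\mathbb E_{c\in C_m(V)}\prod_{\omega\in\{0,1\}^m}g^{\omega}(c_\omega),$$ where $g^\omega=g$ if $|\omega|$ is even and $g^\omega=\overline g$ if $|\omega|$ is odd; call $X$ $(\eta,m)$-uniform if $\|1_X-\mathbb E 1_X\|_{U_m}<\eta$. For every $\delta>0$, every $0<\epsilon<\alpha$, every $\eta<(\epsilon\delta)^B$, every $(\eta,m)$-uniform subset $X\subseteq V$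 of density $|X|/|V|=\delta$, and every $f:X\to H$ such that $f_m(c)=0$ for at least $(1-\epsilon)|C_m(X)|$ of the cubes $c\in C_m(X)$, there exists a function $h:V\to H$ such that $h_m(c)=0$ for all $c\in C_m(V)$ and $h(x)=f(x)$ for at least $(1-C\epsilon)|X|$ of the elements $x\in X$. -/

import Mathlib

open scoped BigOperators

noncomputable section

/-- The vertex `u + ∑ i, ω i • v i` of the `m`-cube `(u | v)`, where `c = (u, v)`. -/
def cubeVertex {V : Type*} [AddCommGroup V] {m : ℕ} (c : V × (Fin m → V))
    (ω : Fin m → Fin 2) : V :=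
  c.1 + ∑ i, (ω i : ℕ) • c.2 i

/-- `|ω| = ∑ i, ω i` for `ω ∈ {0,1}^m`. -/
def cubeWeight {m : ℕ} (ω : Fin m → Fin 2) : ℕ := ∑ i, (ω i : ℕ)

/-- `C_m(X)`: the `m`-cubes of `V` all of whose vertices are in `X`. -/
def cubesIn {V : Type*} [AddCommGroup V] (m : ℕ) (X : Set V) : Set (V × (Fin m → V)) :=
  {c | ∀ ω, cubeVertex c ω ∈ X}

/-- The alternating sum `∑_ω (-1)^|ω| F(ω)` of a family indexed by the vertices of a cube. -/
def altSum {H : Type*} [AddCommGroup H] {m : ℕ} (F : (Fin m → Fin 2) → H) : H :=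
  ∑ ω, (-1 : ℤ) ^ cubeWeight ω • F ω

/-- `f_m : C_m(X) → H` for a function `f` defined on the subset `X` only. -/
def cubeSumOn {V H : Type*} [AddCommGroup V] [AddCommGroup H] {m : ℕ} {X : Set V}
    (f : X → H) (c : cubesIn m X) : H :=
  altSum fun ω => f ⟨cubeVertex c.1 ω, c.2 ω⟩

/-- `h_m : C_m(V) → H` for a function `h` defined on all of `V`. -/
def cubeSum {V H : Type*} [AddCommGroup V] [AddCommGroup H] {m : ℕ}
    (h : V → H) (c : V × (Fin m → V)) : H :=
  altSum fun ω => h (cubeVertex c ω)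

/-- The average over all `m`-cubes `c` of `V` of `∏_ω g^ω (c_ω)`, where `g^ω = g` for `|ω|` even
and `g^ω` is the complex conjugate of `g` for `|ω|` odd. -/
def gowersAverage {V : Type*} [AddCommGroup V] [Fintype V] (m : ℕ) (g : V → ℂ) : ℂ :=
  𝔼 c : V × (Fin m → V), ∏ ω : Fin m → Fin 2,
    if Even (cubeWeight ω) then g (cubeVertex c ω) else star (g (cubeVertex c ω))

/-- The Gowers norm: the `2^m`-th root of `gowersAverage m g`. For `m ≥ 1` that average is a
nonnegative real number, so that it is equal to its absolute value. -/
def gowersNorm {V : Type*} [AddCommGroup V] [Fintype V] (m : ℕ) (g : V → ℂ) : ℝ :=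
  ‖gowersAverage m g‖ ^ ((1 : ℝ) / 2 ^ m)

/-- `X` is `(η, m)`-uniform: `‖1_X - 𝔼 1_X‖_{U_m} < η`. -/
def IsGowersUniform {V : Type*} [AddCommGroup V] [Fintype V] (η : ℝ) (m : ℕ) (X : Set V) : Prop :=
  gowersNorm m (fun x => X.indicator (1 : V → ℂ) x - 𝔼 y : V, X.indicator (1 : V → ℂ) y) < η

/-- `P` holds for `ε`-a.e. `a` in the finite type `A`: for at least `(1 - ε)|A|` elements. -/
def HoldsAE {A : Type*} (ε : ℝ) (P : A → Prop) : Prop :=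
  (1 - ε) * (Nat.card A : ℝ) ≤ (Nat.card {a : A // P a} : ℝ)

end

/-! Cubes are embedded in random grids: `z` gives several vectors `z i j` in each direction `i`, and
the grid points are the sums `∑ i, z i (σ i)`. A factor `1_X - δ` at one grid point has small
average against factors each of which misses one of its coordinates (`box_cauchy_schwarz`,
`abs_expect_balanced_le`). Replacing the factors `1_X` by `δ` one at a time gives the counting lemma
`abs_expect_ind_sub_le`.

Its main use is `expect_ind_le_of_cover`. To bound an event `P`, auxiliary grid points are also
required to lie in `X`. They are nearly independent of `P`, so this costs a known power of `δ`.
Together with them `P` forces one of boundedly many events, each on a single box and of known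
rarity. The powers of `δ` cancel, so every error stays a multiple of `ε` with a constant depending
only on `m`.

With this tool, most pairs of cubes with a common base point and other vertices in `X` predict the
same value at that point (`expect_cubeSum_ne_in_le`). A popular prediction extends `f` to all of `V`
(`exists_extension`). An array of `4 ^ m` points then shows that the extension `h` has zero
alternating sum on most cubes of `V`, and on most cubes based in `X` (`expect_cubeSum_ne_zero_le`).
On the whole space a majority argument corrects `h` to an exact solution `h'`
(`exists_polynomial_correction`). If `h'` differs from `f` at `x ∈ X`, then at least half of the
cubes based at `x` are bad for `h`; the bound for cubes based in `X` makes such `x` few relative to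
`|X|`. -/

/-! ### Averages and indicators -/

open Classical in
/-- The indicator of a proposition, as a real number. -/
noncomputable def ind (p : Prop) : ℝ := if p then 1 else 0

lemma ind_of {p : Prop} (h : p) : ind p = 1 := by simp [ind, h]

lemma ind_of_not {p : Prop} (h : ¬p) : ind p = 0 := by simp [ind, h]

lemma ind_nonneg (p : Prop) : 0 ≤ ind p := by
  by_cases h : p <;> simp [ind, h]

lemma ind_le_one (p : Prop) : ind p ≤ 1 := by
  by_cases h : p <;> simp [ind, h]

lemma abs_ind_le_one (p : Prop) : |ind p| ≤ 1 := by
  rw [abs_of_nonneg (ind_nonneg p)]; exact ind_le_one p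

lemma ind_and (p q : Prop) : ind (p ∧ q) = ind p * ind q := by
  by_cases hp : p <;> by_cases hq : q <;> simp [ind, hp, hq]

lemma ind_mono {p q : Prop} (h : p → q) : ind p ≤ ind q := by
  by_cases hp : p
  · rw [ind_of hp, ind_of (h hp)]
  · rw [ind_of_not hp]; exact ind_nonneg q

lemma ind_le_sum {Λ : Type*} (s : Finset Λ) {p : Prop} {q : Λ → Prop}
    (h : p → ∃ l ∈ s, q l) : ind p ≤ ∑ l ∈ s, ind (q l) := by
  by_cases hp : p
  · obtain ⟨l, hl, hq⟩ := h hp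
    rw [ind_of hp, ← ind_of hq]
    exact Finset.single_le_sum (f := fun l => ind (q l)) (fun i _ => ind_nonneg _) hl
  · rw [ind_of_not hp]; exact Finset.sum_nonneg fun i _ => ind_nonneg _

lemma expect_mono {A : Type*} [Fintype A] {f g : A → ℝ} (h : ∀ a, f a ≤ g a) :
    𝔼 a, f a ≤ 𝔼 a, g a :=
  Finset.expect_le_expect fun a _ => h a

lemma expect_nonneg_of {A : Type*} [Fintype A] {f : A → ℝ} (h : ∀ a, 0 ≤ f a) :
    0 ≤ 𝔼 a, f a :=
  Finset.expect_nonneg fun a _ => h a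

lemma expect_ind_le_sum {A Λ : Type*} [Fintype A] (s : Finset Λ) {p : A → Prop}
    {q : Λ → A → Prop} (h : ∀ a, p a → ∃ l ∈ s, q l a) :
    𝔼 a, ind (p a) ≤ ∑ l ∈ s, 𝔼 a, ind (q l a) := by
  rw [← Finset.expect_sum_comm]
  exact expect_mono fun a => ind_le_sum s (h a)

/-- Averaging over a map which is equivariant for a family of shifts reaching every element of
the target is averaging over the target. -/
lemma expect_comp_of_shift {A B : Type*} [Fintype A] [Fintype B] [AddCommGroup A]
    [AddCommGroup B] (φ : A → B) (s : B → A) (h : ∀ a b, φ (a + s b) = φ a + b) (F : B → ℝ) :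
    𝔼 a, F (φ a) = 𝔼 b, F b := by
  have h1 : ∀ b : B, 𝔼 a, F (φ a + b) = 𝔼 a, F (φ a) := fun b =>
    Fintype.expect_equiv (Equiv.addRight (s b)) _ _ fun a => by
      rw [Equiv.coe_addRight, h]
  have h2 : ∀ a : A, 𝔼 b, F (φ a + b) = 𝔼 b, F b := fun a =>
    Fintype.expect_equiv (Equiv.addLeft (φ a)) _ _ fun b => by rw [Equiv.coe_addLeft]
  calc 𝔼 a, F (φ a) = 𝔼 b : B, 𝔼 a, F (φ a + b) := by
        simp_rw [h1]; rw [Fintype.expect_const]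
    _ = 𝔼 a, 𝔼 b, F (φ a + b) := Finset.expect_comm _ _ _
    _ = 𝔼 b, F b := by simp_rw [h2]; rw [Fintype.expect_const]

lemma expect_sq_le {A : Type*} [Fintype A] [Nonempty A] (f : A → ℝ) :
    (𝔼 a, f a) ^ 2 ≤ 𝔼 a, f a ^ 2 := by
  have h := Finset.expect_mul_sq_le_sq_mul_sq Finset.univ f (fun _ : A => (1 : ℝ))
  simpa using h

lemma expect_pow_two_pow_le {A : Type*} [Fintype A] [Nonempty A] (f : A → ℝ) (n : ℕ) :
    (𝔼 a, f a) ^ 2 ^ n ≤ 𝔼 a, f a ^ 2 ^ n := by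
  induction n with
  | zero => simp
  | succ n ih =>
    -- For exponent `2 ^ 0` the average may be negative, so the induction hypothesis can be squared
    -- only from exponent `2 ^ 1` on.
    rcases n with _ | n
    · simpa using expect_sq_le f
    · have h0 : 0 ≤ (𝔼 a, f a) ^ 2 ^ (n + 1) := by
        rw [pow_succ, pow_mul']; positivity
      calc (𝔼 a, f a) ^ 2 ^ (n + 1 + 1) = ((𝔼 a, f a) ^ 2 ^ (n + 1)) ^ 2 := by
            rw [← pow_mul, ← pow_succ]
        _ ≤ (𝔼 a, f a ^ 2 ^ (n + 1)) ^ 2 := pow_le_pow_left₀ h0 ih 2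
        _ ≤ 𝔼 a, (f a ^ 2 ^ (n + 1)) ^ 2 := expect_sq_le _
        _ = 𝔼 a, f a ^ 2 ^ (n + 1 + 1) := by simp_rw [← pow_mul, ← pow_succ]

lemma expect_prod_type {A B : Type*} [Fintype A] [Fintype B] (f : A × B → ℝ) :
    𝔼 p, f p = 𝔼 a, 𝔼 b, f (a, b) := by
  rw [← Finset.expect_product', Finset.univ_product_univ]

/-! ### The box-norm Cauchy–Schwarz inequality -/

lemma expect_fin_cons {V : Type*} [Fintype V] {n : ℕ} (F : (Fin (n + 1) → V) → ℝ) :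
    𝔼 y, F y = 𝔼 v, 𝔼 t : Fin n → V, F (Fin.cons v t) := by
  rw [← expect_prod_type (fun p : V × (Fin n → V) => F (Fin.cons p.1 p.2))]
  exact (Fintype.expect_equiv (Fin.consEquiv fun _ => V) _ _ fun p => rfl).symm

lemma prod_fin_cons {n : ℕ} (P : (Fin (n + 1) → Fin 2) → ℝ) :
    ∏ ω, P ω = ∏ ω : Fin n → Fin 2, P (Fin.cons 0 ω) * P (Fin.cons 1 ω) := by
  rw [← (Fin.consEquiv fun _ => Fin 2).prod_comp, Fintype.prod_prod_type, Fin.prod_univ_two,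
    ← Finset.prod_mul_distrib]
  rfl

/-- Each Cauchy–Schwarz step removes one bounded factor: `B 0` does not see the coordinate `0`, so
it leaves the average over that coordinate, which is then doubled. For each fixed pair of values of
that coordinate, the remaining product has the same shape in one variable fewer. -/
lemma box_cauchy_schwarz {V : Type*} [Fintype V] [Nonempty V] (n : ℕ) (G : (Fin n → V) → ℝ)
    (B : Fin n → (Fin n → V) → ℝ) (hB : ∀ i y, |B i y| ≤ 1)
    (hBi : ∀ i y v, B i (Function.update y i v) = B i y) :
    (𝔼 y, G y * ∏ i, B i y) ^ 2 ^ n ≤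
      𝔼 y : Fin n → V, 𝔼 y' : Fin n → V, ∏ ω : Fin n → Fin 2, G fun i => if ω i = 0 then y i else y' i := by
  induction n with
  | zero =>
    refine le_of_eq ?_
    have : ∀ y y' : Fin 0 → V, y = y' := fun y y' => Subsingleton.elim _ _
    rw [pow_zero, pow_one]
    refine Finset.expect_congr rfl fun y _ => ?_
    rw [Finset.expect_congr rfl (g := fun _ => G y) fun y' _ => ?_, Fintype.expect_const]
    · simp
    · rw [Fintype.prod_unique]
      congr 1; exact this _ _
  | succ n ih =>
    obtain ⟨v₀⟩ := ‹Nonempty V›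
    have : Nonempty V := ⟨v₀⟩
    let Q : V → (Fin n → V) → ℝ := fun v t =>
      G (Fin.cons v t) * ∏ i : Fin n, B i.succ (Fin.cons v t)
    have hB0 : ∀ v (t : Fin n → V),
        B 0 (Fin.cons v t : Fin (n + 1) → V) = B 0 (Fin.cons v₀ t : Fin (n + 1) → V) := by
      intro v t
      rw [← hBi 0 (Fin.cons v₀ t) v, Fin.update_cons_zero]
    have h1 : 𝔼 y, G y * ∏ i, B i y =
        𝔼 t : Fin n → V, B 0 (Fin.cons v₀ t : Fin (n + 1) → V) * 𝔼 v, Q v t := by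
      rw [expect_fin_cons, Finset.expect_comm]
      refine Finset.expect_congr rfl fun t _ => ?_
      rw [Finset.mul_expect]
      refine Finset.expect_congr rfl fun v _ => ?_
      rw [Fin.prod_univ_succ, hB0]
      ring
    have h2 : (𝔼 y, G y * ∏ i, B i y) ^ 2 ≤ 𝔼 v, 𝔼 v', 𝔼 t, Q v t * Q v' t := by
      calc (𝔼 y, G y * ∏ i, B i y) ^ 2
          ≤ 𝔼 t : Fin n → V, (B 0 (Fin.cons v₀ t : Fin (n + 1) → V) * 𝔼 v, Q v t) ^ 2 := by
            rw [h1]; exact expect_sq_le _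
        _ ≤ 𝔼 t : Fin n → V, (𝔼 v, Q v t) ^ 2 := by
            refine expect_mono fun t => ?_
            rw [mul_pow]
            exact mul_le_of_le_one_left (sq_nonneg _) ((sq_le_one_iff_abs_le_one _).2 (hB _ _))
        _ = 𝔼 v, 𝔼 v', 𝔼 t, Q v t * Q v' t := by
            simp_rw [sq, Finset.expect_mul_expect]
            rw [Finset.expect_comm]
            refine Finset.expect_congr rfl fun v _ => ?_
            rw [Finset.expect_comm]
    have h3 : ∀ v v', (𝔼 t, Q v t * Q v' t) ^ 2 ^ n ≤ 𝔼 t : Fin n → V, 𝔼 t' : Fin n → V, ∏ ω : Fin n → Fin 2,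
        (G (Fin.cons v fun i => if ω i = 0 then t i else t' i) *
          G (Fin.cons v' fun i => if ω i = 0 then t i else t' i)) := by
      intro v v'
      have := ih (fun t => G (Fin.cons v t) * G (Fin.cons v' t))
        (fun i t => B i.succ (Fin.cons v t) * B i.succ (Fin.cons v' t))
        (fun i t => by
          rw [abs_mul]; exact mul_le_one₀ (hB _ _) (abs_nonneg _) (hB _ _))
        (fun i t u => by rw [Fin.cons_update, Fin.cons_update, hBi, hBi])
      refine le_trans (le_of_eq ?_) this
      congr 1
      refine Finset.expect_congr rfl fun t _ => ?_
      rw [Finset.prod_mul_distrib]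
      ring
    calc (𝔼 y, G y * ∏ i, B i y) ^ 2 ^ (n + 1)
        = ((𝔼 y, G y * ∏ i, B i y) ^ 2) ^ 2 ^ n := by rw [← pow_mul, ← pow_succ']
      _ ≤ (𝔼 v, 𝔼 v', 𝔼 t, Q v t * Q v' t) ^ 2 ^ n := pow_le_pow_left₀ (sq_nonneg _) h2 _
      _ ≤ 𝔼 v, 𝔼 v', (𝔼 t, Q v t * Q v' t) ^ 2 ^ n :=
          (expect_pow_two_pow_le _ _).trans (expect_mono fun v => expect_pow_two_pow_le _ _)
      _ ≤ 𝔼 v, 𝔼 v', 𝔼 t : Fin n → V, 𝔼 t' : Fin n → V, ∏ ω : Fin n → Fin 2,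
          (G (Fin.cons v fun i => if ω i = 0 then t i else t' i) *
            G (Fin.cons v' fun i => if ω i = 0 then t i else t' i)) :=
          expect_mono fun v => expect_mono fun v' => h3 v v'
      _ = _ := by
          rw [expect_fin_cons]
          refine Finset.expect_congr rfl fun v _ => ?_
          rw [Finset.expect_comm]
          refine Finset.expect_congr rfl fun t _ => ?_
          rw [expect_fin_cons]
          refine Finset.expect_congr rfl fun v' _ => ?_
          refine Finset.expect_congr rfl fun t' _ => ?_
          rw [prod_fin_cons]
          refine Finset.prod_congr rfl fun ω _ => ?_
          congr 2
          · funext i; refine Fin.cases ?_ (fun i => ?_) i <;> simp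
          · funext i; refine Fin.cases ?_ (fun i => ?_) i <;> simp

/-! ### Counting configurations in a uniform set -/

/-- The balanced indicator function `1_X - δ`. -/
noncomputable def balanced {V : Type*} (X : Set V) (δ : ℝ) (x : V) : ℝ := ind (x ∈ X) - δ

/-- The real form of `(η, m)`-uniformity of a set of density `δ`. -/
def BoxUniform {V : Type*} [AddCommGroup V] [Fintype V] (m : ℕ) (X : Set V) (δ η : ℝ) : Prop :=
  𝔼 c : V × (Fin m → V), ∏ ω, balanced X δ (cubeVertex c ω) ≤ η ^ 2 ^ m

lemma expect_ind_mem {V : Type*} [Fintype V] (X : Set V) :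
    𝔼 x, ind (x ∈ X) = (Nat.card X : ℝ) / Nat.card V := by
  classical
  rw [Fintype.expect_eq_sum_div_card]
  simp [ind, Nat.card_eq_fintype_card, Fintype.card_subtype]

/-- The balanced indicator is real, so conjugation disappears and raising to the power `2 ^ m`
undoes the root. The sign of `η` comes from the norm being nonnegative. -/
lemma IsGowersUniform.boxUniform {V : Type*} [AddCommGroup V] [Fintype V] {m : ℕ} {X : Set V}
    {δ η : ℝ} (hX : (Nat.card X : ℝ) / (Nat.card V : ℝ) = δ) (h : IsGowersUniform η m X) :
    0 ≤ η ∧ BoxUniform m X δ η := by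
  classical
  have hind : ∀ x, X.indicator (1 : V → ℂ) x = (ind (x ∈ X) : ℝ) := by
    intro x
    by_cases hx : x ∈ X <;> simp [ind, hx]
  have hexp : 𝔼 y : V, X.indicator (1 : V → ℂ) y = (δ : ℝ) := by
    rw [← hX, ← expect_ind_mem]
    simp_rw [hind]
    exact (map_expect (algebraMap ℝ ℂ) (fun y => ind (y ∈ X)) Finset.univ).symm
  have havg : gowersAverage m
      (fun x => X.indicator (1 : V → ℂ) x - 𝔼 y : V, X.indicator (1 : V → ℂ) y) =
      ((𝔼 c : V × (Fin m → V), ∏ ω, balanced X δ (cubeVertex c ω) : ℝ) : ℂ) := by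
    rw [gowersAverage]
    refine Eq.trans ?_ (map_expect (algebraMap ℝ ℂ) _ Finset.univ).symm
    refine Finset.expect_congr rfl fun c _ => ?_
    rw [map_prod]
    refine Finset.prod_congr rfl fun ω _ => ?_
    rw [hexp, hind, ← Complex.ofReal_sub]
    have : star (((ind (cubeVertex c ω ∈ X) - δ : ℝ)) : ℂ) =
        ((ind (cubeVertex c ω ∈ X) - δ : ℝ) : ℂ) := Complex.conj_ofReal _
    rw [this, ite_self]
    rfl
  unfold IsGowersUniform gowersNorm at h
  rw [havg, Complex.norm_real] at h
  set A := 𝔼 c : V × (Fin m → V), ∏ ω, balanced X δ (cubeVertex c ω)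
  have hroot : (0 : ℝ) ≤ ‖A‖ ^ ((1 : ℝ) / 2 ^ m) := by positivity
  refine ⟨hroot.trans h.le, ?_⟩
  calc A ≤ ‖A‖ := Real.le_norm_self A
    _ = (‖A‖ ^ ((1 : ℝ) / 2 ^ m)) ^ 2 ^ m := by
        rw [← Real.rpow_natCast, ← Real.rpow_mul (norm_nonneg _)]
        simp
    _ ≤ η ^ 2 ^ m := pow_le_pow_left₀ hroot h.le _

section Grid

variable {V J : Type*} [AddCommGroup V] {m : ℕ}

/-- The point of a grid selected by a choice of an option in each direction. -/
def gridPt (z : Fin m → J → V) (σ : Fin m → J) : V := ∑ i, z i (σ i)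

/-- The vertex `ω` of the box with opposite corners `a` and `b`. -/
def pick (a b : Fin m → J) (ω : Fin m → Fin 2) : Fin m → J :=
  fun i => if ω i = 0 then a i else b i

/-- The cube of `V` spanned by the box of a grid with opposite corners `a` and `b`. -/
def boxCube (z : Fin m → J → V) (a b : Fin m → J) : V × (Fin m → V) :=
  (gridPt z a, fun i => z i (b i) - z i (a i))

lemma fin_two_smul (w : Fin 2) (x y : V) : x + (w : ℕ) • (y - x) = if w = 0 then x else y := by
  fin_cases w <;> simp

lemma cubeVertex_boxCube (z : Fin m → J → V) (a b : Fin m → J) (ω : Fin m → Fin 2) :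
    cubeVertex (boxCube z a b) ω = gridPt z (pick a b ω) := by
  unfold cubeVertex boxCube gridPt pick
  rw [← Finset.sum_add_distrib]
  refine Finset.sum_congr rfl fun i _ => ?_
  rw [fin_two_smul]
  split_ifs <;> rfl

lemma cubeVertex_zero (c : V × (Fin m → V)) : cubeVertex c 0 = c.1 := by simp [cubeVertex]

lemma pick_injective {a b : Fin m → J} (h : ∀ i, a i ≠ b i) : Function.Injective (pick a b) := by
  intro ω ω' hω
  funext i
  have hi := congrFun hω i
  unfold pick at hi
  have h2 : ∀ w w' : Fin 2, (if w = 0 then a i else b i) = (if w' = 0 then a i else b i) →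
      w = w' := by
    intro w w' hw
    fin_cases w <;> fin_cases w' <;> first | rfl | exact absurd hw (h i) | exact absurd hw (h i).symm
  exact h2 _ _ hi

/-- `P z` does not depend on the coordinate `z i j`. -/
def FreeAt (P : (Fin m → J → V) → Prop) (i : Fin m) (j : J) : Prop :=
  ∀ z z', (∀ i' j', (i' ≠ i ∨ j' ≠ j) → z i' j' = z' i' j') → (P z ↔ P z')

lemma gridPt_congr {σ : Fin m → J} {i : Fin m} {j : J} (h : σ i ≠ j) {z z' : Fin m → J → V}
    (hz : ∀ i' j', (i' ≠ i ∨ j' ≠ j) → z i' j' = z' i' j') : gridPt z σ = gridPt z' σ := by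
  refine Finset.sum_congr rfl fun i' _ => hz _ _ ?_
  by_cases hi : i' = i
  · subst hi; exact Or.inr h
  · exact Or.inl hi

lemma boxCube_congr {a b : Fin m → J} {i : Fin m} {j : J} (ha : a i ≠ j) (hb : b i ≠ j)
    {z z' : Fin m → J → V} (hz : ∀ i' j', (i' ≠ i ∨ j' ≠ j) → z i' j' = z' i' j') :
    boxCube z a b = boxCube z' a b := by
  unfold boxCube
  rw [gridPt_congr ha hz]
  congr 1
  funext i'
  have h : ∀ c : Fin m → J, c i ≠ j → z i' (c i') = z' i' (c i') := by
    intro c hc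
    apply hz
    by_cases hi : i' = i
    · subst hi; exact Or.inr hc
    · exact Or.inl hi
  rw [h a ha, h b hb]

lemma freeAt_boxCube (Q : V × (Fin m → V) → Prop) {a b : Fin m → J} {i : Fin m} {j : J}
    (ha : a i ≠ j) (hb : b i ≠ j) : FreeAt (fun z => Q (boxCube z a b)) i j := fun z z' hz => by
  simp only [boxCube_congr ha hb hz]

lemma freeAt_boxCube_pair (Q : V × (Fin m → V) → V × (Fin m → V) → Prop) {a b b' : Fin m → J}
    {i : Fin m} {j : J} (ha : a i ≠ j) (hb : b i ≠ j) (hb' : b' i ≠ j) :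
    FreeAt (fun z => Q (boxCube z a b) (boxCube z a b')) i j := fun z z' hz => by
  simp only [boxCube_congr ha hb hz, boxCube_congr ha hb' hz]

variable [Fintype V] [Fintype J]

/-- A nondegenerate box of a uniform random grid is a uniform random cube. Translating every option
of one direction moves the base point and fixes the edges, which is where `1 ≤ m` enters; moving the
option `b i` alone changes only the edge `i`. -/
lemma expect_boxCube [DecidableEq J] (hm : 1 ≤ m) {a b : Fin m → J} (hab : ∀ i, a i ≠ b i)
    (F : V × (Fin m → V) → ℝ) : 𝔼 z : Fin m → J → V, F (boxCube z a b) = 𝔼 c, F c := by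
  refine expect_comp_of_shift (fun z => boxCube z a b)
    (fun c i j => (if i = ⟨0, hm⟩ then c.1 else 0) + if j = b i then c.2 i else 0)
    (fun z c => ?_) F
  ext i
  · simp [boxCube, gridPt, Finset.sum_add_distrib, hab]
  · simp [boxCube, hab]
    abel

lemma expect_boxCube_pair [DecidableEq J] (hm : 1 ≤ m) {a b b' : Fin m → J}
    (hab : ∀ i, a i ≠ b i) (hab' : ∀ i, a i ≠ b' i) (hbb' : ∀ i, b i ≠ b' i)
    (F : V × (Fin m → V) → V × (Fin m → V) → ℝ) :
    𝔼 z : Fin m → J → V, F (boxCube z a b) (boxCube z a b') =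
      𝔼 x, 𝔼 v, 𝔼 v', F (x, v) (x, v') := by
  have h := expect_comp_of_shift
    (fun z : Fin m → J → V => (gridPt z a, (boxCube z a b).2, (boxCube z a b').2))
    (fun c i j => (if i = ⟨0, hm⟩ then c.1 else 0) + ((if j = b i then c.2.1 i else 0) +
      if j = b' i then c.2.2 i else 0))
    (fun z c => by
      ext i
      · simp [gridPt, Finset.sum_add_distrib, hab, hab']
      · simp [boxCube, hab, hab', hbb']
        abel
      · simp [boxCube, hab, hab', (hbb' _).symm]
        abel)
    (fun p => F (p.1, p.2.1) (p.1, p.2.2))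
  simp_rw [expect_prod_type] at h
  exact h

/-- The generalized von Neumann inequality: a balanced factor at `σ₀` is negligible against the
indicator of any event free at a coordinate of `σ₀` and of other points being in `X`. -/
lemma abs_expect_balanced_le [DecidableEq J] (hm : 1 ≤ m) {X : Set V} {δ η : ℝ}
    (hη : 0 ≤ η) (hX : BoxUniform m X δ η) (P : (Fin m → J → V) → Prop) (σ₀ : Fin m → J)
    {i₀ : Fin m} (hP : FreeAt P i₀ (σ₀ i₀)) (S : Finset (Fin m → J)) (hS : σ₀ ∉ S) :
    |𝔼 z : Fin m → J → V, balanced X δ (gridPt z σ₀) * ind (P z ∧ ∀ σ ∈ S, gridPt z σ ∈ X)|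
      ≤ η := by
  classical
  have hdiff : ∀ σ ∈ S, ∃ i, σ i ≠ σ₀ i := by
    intro σ hσ
    by_contra! hc
    exact hS (funext hc ▸ hσ)
  -- A direction in which `σ` differs from `σ₀`: the point `σ` is then independent of the coordinate
  -- of `σ₀` in that direction. The default is never reached on `S`.
  let ix : (Fin m → J) → Fin m := fun σ => if h : ∃ i, σ i ≠ σ₀ i then h.choose else i₀
  have hix : ∀ σ ∈ S, σ (ix σ) ≠ σ₀ (ix σ) := by
    intro σ hσ
    have h := hdiff σ hσ
    simp only [ix, dif_pos h]
    exact h.choose_spec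
  -- Resamples only the coordinates used by `σ₀`, as fresh variables `y`. The bound is then proved
  -- for each fixed value of the others.
  let sub : (Fin m → J → V) → (Fin m → V) → Fin m → J → V :=
    fun z y i j => if j = σ₀ i then y i else z i j
  have hsub : ∀ F : (Fin m → J → V) → ℝ, 𝔼 z, F z = 𝔼 z, 𝔼 y, F (sub z y) := by
    intro F
    rw [← expect_prod_type (fun p : (Fin m → J → V) × (Fin m → V) => F (sub p.1 p.2))]
    refine (expect_comp_of_shift (fun p : (Fin m → J → V) × (Fin m → V) => sub p.1 p.2)
      (fun z => (z, fun i => z i (σ₀ i))) (fun p z => ?_) F).symm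
    funext i j
    by_cases hj : j = σ₀ i <;> simp [sub, hj]
  rw [hsub]
  refine (Finset.abs_expect_le _ _).trans ?_
  refine Finset.expect_le Finset.univ_nonempty fun z _ => ?_
  -- The factors are grouped by a direction they do not depend on; `P` goes with `i₀`.
  let B : Fin m → (Fin m → V) → ℝ := fun i y =>
    ind ((i = i₀ → P (sub z y)) ∧ ∀ σ ∈ S, ix σ = i → gridPt (sub z y) σ ∈ X)
  have hprod : ∀ y, ind (P (sub z y) ∧ ∀ σ ∈ S, gridPt (sub z y) σ ∈ X) = ∏ i, B i y := by
    intro y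
    by_cases hall : P (sub z y) ∧ ∀ σ ∈ S, gridPt (sub z y) σ ∈ X
    · rw [ind_of hall, Finset.prod_eq_one]
      intro i _
      exact ind_of ⟨fun _ => hall.1, fun σ hσ _ => hall.2 σ hσ⟩
    · rw [ind_of_not hall]
      have : ∃ i, ¬ ((i = i₀ → P (sub z y)) ∧ ∀ σ ∈ S, ix σ = i → gridPt (sub z y) σ ∈ X) := by
        by_contra! hc
        exact hall ⟨(hc i₀).1 rfl, fun σ hσ => (hc (ix σ)).2 σ hσ rfl⟩
      obtain ⟨i, hi⟩ := this
      exact (Finset.prod_eq_zero (Finset.mem_univ i) (ind_of_not hi)).symm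
  have hagree : ∀ (i : Fin m) (y : Fin m → V) (v : V) (i' : Fin m) (j' : J),
      (i' ≠ i ∨ j' ≠ σ₀ i) → sub z (Function.update y i v) i' j' = sub z y i' j' := by
    intro i y v i' j' h
    by_cases hi : i' = i
    · subst hi
      have hj : j' ≠ σ₀ i' := h.resolve_left (fun h => h rfl)
      simp [sub, hj]
    · simp [sub, hi]
  have hB : ∀ i y v, B i (Function.update y i v) = B i y := by
    intro i y v
    have hz := hagree i y v
    have h1 : (i = i₀ → P (sub z (Function.update y i v))) ↔ (i = i₀ → P (sub z y)) := by
      refine forall_congr' fun hi => ?_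
      subst hi
      exact hP _ _ hz
    have h2 : (∀ σ ∈ S, ix σ = i → gridPt (sub z (Function.update y i v)) σ ∈ X) ↔
        ∀ σ ∈ S, ix σ = i → gridPt (sub z y) σ ∈ X := by
      refine forall₂_congr fun σ hσ => forall_congr' fun hi => ?_
      rw [gridPt_congr (hi ▸ hix σ hσ) hz]
    simp only [B, h1, h2]
  have key := box_cauchy_schwarz m (fun y : Fin m → V => balanced X δ (∑ i, y i)) B
    (fun i y => abs_ind_le_one _) hB
  have hpt : ∀ y, gridPt (sub z y) σ₀ = ∑ i, y i := by
    intro y; simp [gridPt, sub]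
  have hlhs : 𝔼 y, balanced X δ (gridPt (sub z y) σ₀) *
      ind (P (sub z y) ∧ ∀ σ ∈ S, gridPt (sub z y) σ ∈ X) =
      𝔼 y, balanced X δ (∑ i, y i) * ∏ i, B i y := by
    simp_rw [hpt, hprod]
  rw [hlhs]
  have hrhs : 𝔼 y : Fin m → V, 𝔼 y' : Fin m → V, ∏ ω : Fin m → Fin 2,
      balanced X δ (∑ i, if ω i = 0 then y i else y' i) ≤ η ^ 2 ^ m := by
    refine le_trans (le_of_eq ?_) hX
    rw [← expect_prod_type (fun p : (Fin m → V) × (Fin m → V) => ∏ ω : Fin m → Fin 2,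
      balanced X δ (∑ i, if ω i = 0 then p.1 i else p.2 i)),
      ← expect_comp_of_shift
        (fun p : (Fin m → V) × (Fin m → V) => ((∑ i, p.1 i, fun i => p.2 i - p.1 i) :
          V × (Fin m → V)))
        (fun c => (Pi.single ⟨0, hm⟩ c.1, Pi.single ⟨0, hm⟩ c.1 + c.2)) _
        (fun c => ∏ ω, balanced X δ (cubeVertex c ω))]
    · refine Finset.expect_congr rfl fun p _ => Finset.prod_congr rfl fun ω _ => ?_
      congr 1
      simp only [cubeVertex]
      rw [← Finset.sum_add_distrib]
      exact Finset.sum_congr rfl fun i _ => (fin_two_smul _ _ _).symm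
    · intro p c
      ext i
      · simp [Finset.sum_add_distrib]
      · simp
        abel
  have hpow := key.trans hrhs
  have : |𝔼 y, balanced X δ (∑ i, y i) * ∏ i, B i y| ^ 2 ^ m ≤ η ^ 2 ^ m := by
    rwa [Even.pow_abs]
    exact (Nat.even_pow.2 ⟨even_two, by omega⟩)
  exact le_of_pow_le_pow_left₀ (by positivity) hη this

/-- Counting lemma: the points of `S` lie in `X` nearly independently of each other and of any
event that is free at each of them. -/
lemma abs_expect_ind_sub_le [DecidableEq J] (hm : 1 ≤ m) {X : Set V} {δ η : ℝ}
    (hδ0 : 0 ≤ δ) (hδ1 : δ ≤ 1) (hη : 0 ≤ η) (hX : BoxUniform m X δ η)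
    (P : (Fin m → J → V) → Prop) (S : Finset (Fin m → J))
    (hP : ∀ σ ∈ S, ∃ i, FreeAt P i (σ i)) :
    |𝔼 z : Fin m → J → V, ind (P z ∧ ∀ σ ∈ S, gridPt z σ ∈ X) - δ ^ S.card * 𝔼 z, ind (P z)|
      ≤ S.card * η := by
  induction S using Finset.induction_on with
  | empty => simp
  | insert σ₀ S hσ ih =>
    have ih' := ih fun σ hσ => hP σ (Finset.mem_insert_of_mem hσ)
    obtain ⟨i₀, hi₀⟩ := hP σ₀ (Finset.mem_insert_self _ _)
    have h1 := abs_expect_balanced_le hm hη hX P σ₀ hi₀ S hσ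
    set E := 𝔼 z : Fin m → J → V, ind (P z ∧ ∀ σ ∈ S, gridPt z σ ∈ X)
    -- Splits the indicator at `σ₀` as its balanced part plus the constant `δ`.
    have h2 : 𝔼 z : Fin m → J → V, ind (P z ∧ ∀ σ ∈ insert σ₀ S, gridPt z σ ∈ X) =
        (𝔼 z : Fin m → J → V,
          balanced X δ (gridPt z σ₀) * ind (P z ∧ ∀ σ ∈ S, gridPt z σ ∈ X)) + δ * E := by
      rw [Finset.mul_expect, ← Finset.expect_add_distrib]
      refine Finset.expect_congr rfl fun z _ => ?_
      rw [balanced, ← add_mul, sub_add_cancel, ← ind_and]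
      congr 1
      rw [Finset.forall_mem_insert]
      exact propext (by tauto)
    rw [h2, Finset.card_insert_of_notMem hσ, pow_succ]
    set G := 𝔼 z : Fin m → J → V,
      balanced X δ (gridPt z σ₀) * ind (P z ∧ ∀ σ ∈ S, gridPt z σ ∈ X)
    have h3 : G + δ * E - δ ^ S.card * δ * 𝔼 z, ind (P z) =
        G + δ * (E - δ ^ S.card * 𝔼 z, ind (P z)) := by ring
    rw [h3]
    calc _ ≤ |G| + |δ * (E - δ ^ S.card * 𝔼 z, ind (P z))| := abs_add_le _ _
      _ ≤ η + 1 * (S.card * η) := by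
          rw [abs_mul, abs_of_nonneg hδ0]
          gcongr
      _ = _ := by push_cast; ring

end Grid

/-! ### Alternating sums -/

section AltSum

variable {H : Type*} [AddCommGroup H] {m : ℕ}

lemma cubeWeight_zero : cubeWeight (0 : Fin m → Fin 2) = 0 := by simp [cubeWeight]

lemma neg_one_pow_cubeWeight_flip (ω : Fin m → Fin 2) (k : Fin m) :
    (-1 : ℤ) ^ cubeWeight (Function.update ω k (1 - ω k)) = -(-1) ^ cubeWeight ω := by
  have h : ∀ ω' : Fin m → Fin 2, cubeWeight ω' =
      (ω' k : ℕ) + ∑ i ∈ Finset.univ.erase k, (ω' i : ℕ) := fun ω' =>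
    (Finset.add_sum_erase _ (fun i => (ω' i : ℕ)) (Finset.mem_univ k)).symm
  have hr : ∑ i ∈ Finset.univ.erase k, (Function.update ω k (1 - ω k) i : ℕ) =
      ∑ i ∈ Finset.univ.erase k, (ω i : ℕ) :=
    Finset.sum_congr rfl fun i hi => by
      rw [Function.update_of_ne (Finset.ne_of_mem_erase hi)]
  rw [h ω, h (Function.update ω k (1 - ω k)), hr, Function.update_self, pow_add, pow_add]
  generalize ω k = w
  fin_cases w <;> simp

lemma altSum_comm (G : (Fin m → Fin 2) → (Fin m → Fin 2) → H) :
    altSum (fun ω => altSum (G ω)) = altSum fun ρ => altSum fun ω => G ω ρ := by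
  simp only [altSum, Finset.smul_sum]
  rw [Finset.sum_comm]
  exact Finset.sum_congr rfl fun ρ _ => Finset.sum_congr rfl fun ω _ => smul_comm _ _ _

lemma altSum_eq_zero_term (F : (Fin m → Fin 2) → H) (h : ∀ ω, ω ≠ 0 → F ω = 0) :
    altSum F = F 0 := by
  rw [altSum, Fintype.sum_eq_single 0 fun ω hω => by rw [h ω hω, smul_zero], cubeWeight_zero]
  simp

/-- Double counting in an array of cubes: after exchanging the sums, only the cube `ρ = 0`
contributes. -/
lemma altSum_altSum (G : (Fin m → Fin 2) → (Fin m → Fin 2) → H)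
    (h : ∀ ρ, ρ ≠ 0 → altSum (fun ω => G ω ρ) = 0) :
    altSum (fun ω => altSum (G ω)) = altSum fun ω => G ω 0 := by
  rw [altSum_comm, altSum_eq_zero_term _ h]

lemma altSum_add (F G : (Fin m → Fin 2) → H) :
    altSum (fun ω => F ω + G ω) = altSum F + altSum G := by
  simp [altSum, smul_add, Finset.sum_add_distrib]

lemma altSum_sub (F G : (Fin m → Fin 2) → H) :
    altSum (fun ω => F ω - G ω) = altSum F - altSum G := by
  simp [altSum, smul_sub, Finset.sum_sub_distrib]

/-- Two families which agree off the vertex `0` have alternating sums which differ by the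
difference at `0`. -/
lemma altSum_sub_of_eq (F G : (Fin m → Fin 2) → H) (h : ∀ ω, ω ≠ 0 → F ω = G ω) :
    altSum F - altSum G = F 0 - G 0 := by
  rw [← altSum_sub, altSum_eq_zero_term _ fun ω hω => sub_eq_zero.2 (h ω hω)]

variable {J : Type*}

/-- Subdivision of a box in one direction. -/
lemma altSum_subdivide (G : (Fin m → J) → H) (a b : Fin m → J) (k : Fin m) (r : J) :
    altSum (fun ω => G (pick a b ω)) =
      altSum (fun ω => G (pick a (Function.update b k r) ω)) +
        altSum (fun ω => G (pick (Function.update a k r) b ω)) := by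
  rw [← sub_eq_zero, ← altSum_add, ← altSum_sub]
  -- At each `ω` one piece keeps the old vertex and the other has its projection to the common face
  -- `r`. That projection ignores `ω k`, so flipping `ω k` cancels the remainder in pairs.
  have hterm : ∀ ω, G (pick a b ω) - (G (pick a (Function.update b k r) ω) +
      G (pick (Function.update a k r) b ω)) = -G (Function.update (pick a b ω) k r) := by
    intro ω
    by_cases hk : ω k = 0
    · have h1 : pick a (Function.update b k r) ω = pick a b ω := by
        funext i
        by_cases hi : i = k
        · subst hi; simp [pick, hk]
        · simp [pick, hi]
      have h2 : pick (Function.update a k r) b ω = Function.update (pick a b ω) k r := by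
        funext i
        by_cases hi : i = k
        · subst hi; simp [pick, hk]
        · simp [pick, hi]
      rw [h1, h2]; abel
    · have h1 : pick a (Function.update b k r) ω = Function.update (pick a b ω) k r := by
        funext i
        by_cases hi : i = k
        · subst hi; simp [pick, hk]
        · simp [pick, hi]
      have h2 : pick (Function.update a k r) b ω = pick a b ω := by
        funext i
        by_cases hi : i = k
        · subst hi; simp [pick, hk]
        · simp [pick, hi]
      rw [h1, h2]; abel
  simp_rw [hterm, altSum]
  refine Finset.sum_involution (fun ω _ => Function.update ω k (1 - ω k)) ?_ ?_ ?_ ?_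
  · intro ω _
    have : Function.update (pick a b (Function.update ω k (1 - ω k))) k r =
        Function.update (pick a b ω) k r := by
      funext i
      by_cases hi : i = k
      · subst hi; simp
      · simp [pick, hi]
    rw [this, neg_one_pow_cubeWeight_flip, neg_smul, add_neg_cancel]
  · intro ω _ _ hω
    have := congrFun hω k
    rw [Function.update_self] at this
    revert this
    generalize ω k = w
    fin_cases w <;> decide
  · intro ω _; exact Finset.mem_univ _
  · intro ω _
    simp

/-- Moving the corner of a box from `p` to `q` one direction at a time. -/
lemma altSum_eq_of_links (G : (Fin m → J) → H) (a : Fin m → J) (p q : J)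
    (h : ∀ k : Fin m, altSum (fun ω => G (pick (Function.update a k q)
      (fun i => if i < k then q else p) ω)) = 0) :
    altSum (fun ω => G (pick a (fun _ => p) ω)) = altSum fun ω => G (pick a (fun _ => q) ω) := by
  have key : ∀ n : ℕ, n ≤ m → altSum (fun ω => G (pick a (fun _ => p) ω)) =
      altSum fun ω => G (pick a (fun i : Fin m => if (i : ℕ) < n then q else p) ω) := by
    intro n
    induction n with
    | zero => intro _; simp
    | succ n ih =>
      intro hn
      -- Subdividing at `q` in the direction `n` gives the next box plus the `n`-th link.
      rw [ih (by omega), altSum_subdivide G a _ ⟨n, hn⟩ q]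
      have h1 := h ⟨n, hn⟩
      simp only [Fin.lt_def] at h1
      rw [h1, add_zero]
      congr 1
      funext ω
      congr 2
      funext i
      by_cases hi : i = ⟨n, hn⟩
      · subst hi; simp
      · have : (i : ℕ) ≠ n := fun hc => hi (Fin.ext hc)
        rw [Function.update_of_ne hi]
        have : (i : ℕ) < n ↔ (i : ℕ) < n + 1 := by omega
        simp [this]
  rw [key m le_rfl]
  simp

end AltSum

lemma cubeSum_boxCube {V H J : Type*} [AddCommGroup V] [AddCommGroup H] {m : ℕ} (F : V → H)
    (z : Fin m → J → V) (a b : Fin m → J) :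
    cubeSum F (boxCube z a b) = altSum fun ω => F (gridPt z (pick a b ω)) := by
  simp only [cubeSum, cubeVertex_boxCube]

lemma exists_pick_eq {J : Type*} {m : ℕ} {a b σ : Fin m → J} (h : ∀ i, σ i = a i ∨ σ i = b i) :
    ∃ ω, pick a b ω = σ := by
  classical
  refine ⟨fun i => if σ i = a i then 0 else 1, ?_⟩
  funext i
  rcases h i with hi | hi
  · simp [pick, hi]
  · by_cases hc : σ i = a i
    · simp [pick, hc]
    · simp [pick, hi ▸ hc, hi]

lemma pick_zero {J : Type*} {m : ℕ} (a b : Fin m → J) : pick a b 0 = a := by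
  funext i; simp [pick]

section BoxPts

variable {J : Type*} [DecidableEq J] {m : ℕ}

/-- The vertices of a box. -/
def boxPts (a b : Fin m → J) : Finset (Fin m → J) := Finset.univ.image (pick a b)

/-- The vertices of a box other than its corner `a`. -/
def puncturedBoxPts (a b : Fin m → J) : Finset (Fin m → J) :=
  (Finset.univ.erase 0).image (pick a b)

lemma card_fin_two_erase : (Finset.univ.erase (0 : Fin m → Fin 2)).card = 2 ^ m - 1 := by
  rw [Finset.card_erase_of_mem (Finset.mem_univ _)]; simp

lemma card_boxPts_le (a b : Fin m → J) : (boxPts a b).card ≤ 2 ^ m :=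
  Finset.card_image_le.trans (by simp)

lemma card_puncturedBoxPts_le (a b : Fin m → J) : (puncturedBoxPts a b).card ≤ 2 ^ m - 1 :=
  Finset.card_image_le.trans card_fin_two_erase.le

lemma card_puncturedBoxPts {a b : Fin m → J} (h : ∀ i, a i ≠ b i) :
    (puncturedBoxPts a b).card = 2 ^ m - 1 := by
  rw [puncturedBoxPts, Finset.card_image_of_injective _ (pick_injective h), card_fin_two_erase]

/-- Provides the freeness needed for counting: an event on a box is free at each grid point outside
it. -/
lemma exists_ne_of_notMem_boxPts {a b σ : Fin m → J} (h : σ ∉ boxPts a b) :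
    ∃ i, a i ≠ σ i ∧ b i ≠ σ i := by
  by_contra! hc
  obtain ⟨ω, hω⟩ := exists_pick_eq (a := a) (b := b) (σ := σ) fun i => by
    by_cases hi : a i = σ i
    · exact Or.inl hi.symm
    · exact Or.inr (hc i hi).symm
  exact h (Finset.mem_image.2 ⟨ω, Finset.mem_univ _, hω⟩)

end BoxPts

/-! ### Transfer of error bounds through a configuration -/

section Transfer

variable {V J : Type*} [AddCommGroup V] [Fintype V] [Fintype J] [DecidableEq J] {m : ℕ}

/-- If an event together with the points of `S` being in `X` forces one of finitely many events
on boxes of the configuration `E`, then bounds for these events bound its probability. -/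
lemma expect_ind_le_of_cover (hm : 1 ≤ m) {X : Set V} {δ η ε κ : ℝ} (hδ0 : 0 < δ) (hδ1 : δ ≤ 1)
    (hη : 0 ≤ η) (hX : BoxUniform m X δ η) (hκ : 0 ≤ κ) {K : ℕ} (hηK : η ≤ ε * δ ^ K)
    (E S : Finset (Fin m → J)) (hEK : E.card ≤ K)
    (P : (Fin m → J → V) → Prop) (hP : ∀ σ ∈ S, ∃ i, FreeAt P i (σ i))
    {Λ : Type*} (s : Finset Λ) (a b : Λ → Fin m → J) (hab : ∀ l i, a l i ≠ b l i)
    (Q : Λ → V × (Fin m → V) → Prop) (t : Λ → ℕ)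
    (ht : ∀ l ∈ s, (E ∩ boxPts (a l) (b l)).card ≤ t l)
    (hQ : ∀ l ∈ s, 𝔼 c, ind (Q l c) ≤ κ * δ ^ t l)
    (hcover : ∀ z, P z → (∀ σ ∈ S, gridPt z σ ∈ X) → ∃ l ∈ s, Q l (boxCube z (a l) (b l)) ∧
      ∀ σ ∈ E \ boxPts (a l) (b l), gridPt z σ ∈ X)
    (r : ℕ) (hr : S.card + r ≤ E.card) :
    𝔼 z, ind (P z) ≤ (s.card * κ + (s.card + 1) * (K * ε)) * δ ^ r := by
  have hpow : ∀ {i j : ℕ}, i ≤ j → δ ^ j ≤ δ ^ i := fun h =>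
    pow_le_pow_of_le_one hδ0.le hδ1 h
  have hε : 0 ≤ ε := by
    by_contra! h
    exact absurd (hη.trans hηK) (not_le.2 (mul_neg_of_neg_of_pos h (by positivity)))
  have herr : ∀ T : Finset (Fin m → J), T.card ≤ E.card → T.card * η ≤ K * ε * δ ^ E.card := by
    intro T hT
    calc (T.card : ℝ) * η ≤ K * (ε * δ ^ E.card) := by
          gcongr
          · exact hT.trans hEK
          · exact hηK.trans (mul_le_mul_of_nonneg_left (hpow hEK) hε)
      _ = _ := by ring
  have h1 := (abs_le.1 (abs_expect_ind_sub_le hm hδ0.le hδ1 hη hX P S hP)).1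
  have h2 : 𝔼 z, ind (P z ∧ ∀ σ ∈ S, gridPt z σ ∈ X) ≤
      ∑ l ∈ s, 𝔼 z, ind (Q l (boxCube z (a l) (b l)) ∧
        ∀ σ ∈ E \ boxPts (a l) (b l), gridPt z σ ∈ X) :=
    expect_ind_le_sum s fun z hz => hcover z hz.1 hz.2
  have h3 : ∀ l ∈ s, 𝔼 z, ind (Q l (boxCube z (a l) (b l)) ∧
      ∀ σ ∈ E \ boxPts (a l) (b l), gridPt z σ ∈ X) ≤ (κ + K * ε) * δ ^ E.card := by
    intro l hl
    have h4 := (abs_le.1 (abs_expect_ind_sub_le hm hδ0.le hδ1 hη hX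
      (fun z => Q l (boxCube z (a l) (b l))) (E \ boxPts (a l) (b l)) fun σ hσ => by
        obtain ⟨i, ha, hb⟩ := exists_ne_of_notMem_boxPts (Finset.mem_sdiff.1 hσ).2
        exact ⟨i, freeAt_boxCube (Q l) ha hb⟩)).2
    have h5 := herr (E \ boxPts (a l) (b l)) (Finset.card_le_card Finset.sdiff_subset)
    rw [expect_boxCube hm (hab l) fun c => ind (Q l c)] at h4
    -- The box accounts for at most `t l` points of `E` and its event already carries `δ ^ t l`; the
    -- points off the box supply the remaining powers.
    have h6 : δ ^ (E \ boxPts (a l) (b l)).card * 𝔼 c, ind (Q l c) ≤ κ * δ ^ E.card := by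
      calc _ ≤ δ ^ (E \ boxPts (a l) (b l)).card * (κ * δ ^ t l) := by
            gcongr; exact hQ l hl
        _ = κ * δ ^ ((E \ boxPts (a l) (b l)).card + t l) := by rw [pow_add]; ring
        _ ≤ κ * δ ^ E.card := by
            refine mul_le_mul_of_nonneg_left (hpow ?_) hκ
            have := Finset.card_sdiff_add_card_inter E (boxPts (a l) (b l))
            have := ht l hl
            omega
    linarith
  have h7 := Finset.sum_le_sum h3
  rw [Finset.sum_const, nsmul_eq_mul] at h7
  have h8 := herr S (by omega)
  -- Since `S.card + r ≤ E.card`, the cost `δ ^ S.card` of the auxiliary points can be cancelled,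
  -- leaving `δ ^ r`.
  have h9 : δ ^ S.card * 𝔼 z, ind (P z) ≤
      δ ^ S.card * ((s.card * κ + (s.card + 1) * (K * ε)) * δ ^ r) := by
    calc _ ≤ (s.card * κ + (s.card + 1) * (K * ε)) * δ ^ E.card := by linarith
      _ ≤ (s.card * κ + (s.card + 1) * (K * ε)) * δ ^ (S.card + r) := by
          exact mul_le_mul_of_nonneg_left (hpow hr) (by positivity)
      _ = _ := by rw [pow_add]; ring
  exact le_of_mul_le_mul_left h9 (by positivity)

end Transfer

/-! ### Self-correction on the whole space -/

section SelfCorrection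

variable {V H : Type*} [AddCommGroup V] [Fintype V] [AddCommGroup H] {m : ℕ}

lemma expect_ind_add_expect_ind_not {A : Type*} [Fintype A] [Nonempty A] (p : A → Prop) :
    𝔼 a, ind (p a) + 𝔼 a, ind (¬p a) = 1 := by
  rw [← Finset.expect_add_distrib, ← Fintype.expect_const (ι := A) (1 : ℝ)]
  refine Finset.expect_congr rfl fun a _ => ?_
  by_cases h : p a <;> simp [ind, h]

lemma exists_not_of_sum_expect_ind_lt_one {A Λ : Type*} [Fintype A] [Nonempty A] (s : Finset Λ)
    (q : Λ → A → Prop) (h : ∑ l ∈ s, 𝔼 a, ind (q l a) < 1) : ∃ a, ∀ l ∈ s, ¬q l a := by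
  by_contra! hc
  have h1 := expect_ind_le_sum (p := fun _ : A => True) s fun a _ => hc a
  simp only [ind_of trivial, Fintype.expect_const] at h1
  linarith

/-- If almost all cubes have zero alternating sum, then at every point almost all pairs of cubes
have the same alternating sum. -/
lemma expect_cubeSum_ne_le (h : V → H) {e : ℝ}
    (he : 𝔼 c : V × (Fin m → V), ind (cubeSum h c ≠ 0) ≤ e) (x : V) :
    𝔼 v' : Fin m → V, 𝔼 v : Fin m → V, ind (cubeSum h (x, v) ≠ cubeSum h (x, v')) ≤ m * e := by
  classical
  rcases Nat.eq_zero_or_pos m with rfl | hm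
  · have : ∀ v v' : Fin 0 → V, cubeSum h (x, v) = cubeSum h (x, v') := fun v v' => by
      rw [Subsingleton.elim v v']
    simp [ind, this _ default]
  let i₀ : Fin m := ⟨0, hm⟩
  let z : (Fin m → V) × (Fin m → V) → Fin m → Fin 3 → V := fun p i j =>
    (if i = i₀ then x else 0) + ![0, p.2 i, p.1 i] j
  have hz : ∀ p (σ : Fin m → Fin 3), gridPt (z p) σ = x + ∑ i, ![0, p.2 i, p.1 i] (σ i) := by
    intro p σ
    simp [gridPt, z, Finset.sum_add_distrib]
  have hcube : ∀ p (j : Fin 3), boxCube (z p) 0 (fun _ => j) =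
      (x, fun i => ![0, p.2 i, p.1 i] j) := by
    intro p j
    ext i
    · simp [boxCube, hz]
    · simp [boxCube, z]
  rw [← expect_prod_type (fun p : (Fin m → V) × (Fin m → V) =>
    ind (cubeSum h (x, p.2) ≠ cubeSum h (x, p.1)))]
  let A : Fin m → Fin m → Fin 3 := fun k => Function.update 0 k 2
  let B : Fin m → Fin m → Fin 3 := fun k i => if i < k then 2 else 1
  have hcov : ∀ p : (Fin m → V) × (Fin m → V), cubeSum h (x, p.2) ≠ cubeSum h (x, p.1) →
      ∃ k ∈ Finset.univ, cubeSum h (boxCube (z p) (A k) (B k)) ≠ 0 := by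
    intro p hp
    by_contra! hc
    apply hp
    have := altSum_eq_of_links (fun σ => h (gridPt (z p) σ)) (0 : Fin m → Fin 3) 1 2
      fun k => by
        have := hc k (Finset.mem_univ _)
        rwa [cubeSum_boxCube] at this
    rw [← cubeSum_boxCube, ← cubeSum_boxCube, hcube, hcube] at this
    exact this
  refine (expect_ind_le_sum Finset.univ hcov).trans ?_
  -- The corner of the link `k` is `x + p.1 k`, so the link is a uniform cube of `V` although `x` is
  -- fixed. This is why the bound holds at every `x`.
  have hlink : ∀ k, 𝔼 p, ind (cubeSum h (boxCube (z p) (A k) (B k)) ≠ 0) ≤ e := by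
    intro k
    refine le_trans (le_of_eq ?_) he
    refine expect_comp_of_shift (fun p => boxCube (z p) (A k) (B k))
      (fun c => (fun i => if i = k then c.1 else if i < k then c.2 i else 0,
        fun i => if i = k then c.1 + c.2 i else if i < k then 0 else c.2 i)) (fun p c => ?_)
      (fun c => ind (cubeSum h c ≠ 0))
    ext i
    · simp only [boxCube, hz, Prod.fst_add]
      rw [add_assoc]
      congr 1
      rw [← Fintype.sum_ite_eq k (fun _ => c.1), ← Finset.sum_add_distrib]
      refine Finset.sum_congr rfl fun i _ => ?_
      by_cases hi : i = k
      · subst hi; simp [A]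
      · simp [A, hi, Ne.symm hi]
    · simp only [boxCube, z, Prod.snd_add, Pi.add_apply]
      by_cases hi : i = k
      · subst hi; simp [A, B]; abel
      · by_cases hik : i < k
        · simp [A, B, hi, hik]
        · simp [A, B, hi, hik]
  calc _ ≤ ∑ _k : Fin m, e := Finset.sum_le_sum fun k _ => hlink k
    _ = m * e := by simp

/-- A function for which almost all cubes have zero alternating sum can be corrected to one for
which all cubes do, in such a way that at every point the corrected value is the one predicted by
almost all cubes. -/
lemma exists_polynomial_correction (h : V → H) {e : ℝ}
    (he : 𝔼 c : V × (Fin m → V), ind (cubeSum h c ≠ 0) ≤ e) (he1 : 2 ^ m * ((m + 1) * e) < 1) :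
    ∃ h' : V → H, (∀ c : V × (Fin m → V), cubeSum h' c = 0) ∧
      ∀ x, 𝔼 v : Fin m → V, ind (h' x - h x + cubeSum h (x, v) ≠ 0) ≤ m * e := by
  classical
  have hex : ∀ x, ∃ v' : Fin m → V,
      𝔼 v, ind (cubeSum h (x, v) ≠ cubeSum h (x, v')) ≤ m * e := fun x => by
    obtain ⟨v', -, hv'⟩ := Finset.exists_le_of_expect_le Finset.univ_nonempty
      (expect_cubeSum_ne_le h he x)
    exact ⟨v', hv'⟩
  choose v₀ hv₀ using hex
  let h' : V → H := fun x => h x - cubeSum h (x, v₀ x)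
  have hh' : ∀ x, 𝔼 v : Fin m → V, ind (h' x - h x + cubeSum h (x, v) ≠ 0) ≤ m * e := by
    intro x
    refine le_trans (expect_mono fun v => ind_mono fun hne => ?_) (hv₀ x)
    contrapose! hne
    simp only [h', hne]
    abel
  refine ⟨h', fun c => ?_, hh'⟩
  -- A random array over the fixed cube `c`: `W p ω` gives the edges of a cube growing from the
  -- vertex `ω` of `c`, and `D p ρ` is the cube formed by the vertices `ρ` of these. Each `W p ω`,
  -- and each `D p ρ` with `ρ ≠ 0`, is uniform, so a union bound finds one array in which everything
  -- behaves.
  let W : (Fin m → V) × (Fin m → Fin m → V) → (Fin m → Fin 2) → Fin m → V :=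
    fun p ω i => p.1 i + ∑ j, (ω j : ℕ) • p.2 i j
  let D : (Fin m → V) × (Fin m → Fin m → V) → (Fin m → Fin 2) → V × (Fin m → V) :=
    fun p ρ => (c.1 + ∑ i, (ρ i : ℕ) • p.1 i, fun j => c.2 j + ∑ i, (ρ i : ℕ) • p.2 i j)
  have hswap : ∀ p ω ρ, cubeVertex (cubeVertex c ω, W p ω) ρ = cubeVertex (D p ρ) ω := by
    intro p ω ρ
    simp only [cubeVertex, W, D, smul_add, Finset.sum_add_distrib, Finset.smul_sum]
    rw [Finset.sum_comm (f := fun i j => (ρ i : ℕ) • (ω j : ℕ) • p.2 i j)]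
    simp_rw [smul_comm (ρ _ : ℕ) (ω _ : ℕ)]
    abel
  have hω : ∀ ω, 𝔼 p, ind (h' (cubeVertex c ω) - h (cubeVertex c ω) +
      cubeSum h (cubeVertex c ω, W p ω) ≠ 0) ≤ m * e := by
    intro ω
    refine le_trans (le_of_eq ?_) (hh' (cubeVertex c ω))
    refine expect_comp_of_shift (fun p => W p ω) (fun v => (v, 0)) (fun p v => ?_)
      (fun v => ind (h' (cubeVertex c ω) - h (cubeVertex c ω) +
        cubeSum h (cubeVertex c ω, v) ≠ 0))
    funext i
    simp [W]
    abel
  have hρ : ∀ ρ, 𝔼 p, ind (ρ ≠ 0 ∧ cubeSum h (D p ρ) ≠ 0) ≤ e := by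
    intro ρ
    by_cases hρ0 : ρ = 0
    · have h0 : 0 ≤ e := (expect_nonneg_of fun c => ind_nonneg _).trans he
      simpa [hρ0, ind] using h0
    · obtain ⟨k, hk⟩ := Function.ne_iff.1 hρ0
      have hk1 : ρ k = 1 := by
        rcases Fin.exists_fin_two.1 ⟨ρ k, rfl⟩ with h | h
        · exact absurd h hk
        · exact h
      refine le_trans (expect_mono fun p => ind_mono And.right) (le_trans (le_of_eq ?_) he)
      refine expect_comp_of_shift (fun p => D p ρ)
        (fun d => (Pi.single k d.1, Pi.single k d.2)) (fun p d => ?_)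
        (fun d => ind (cubeSum h d ≠ 0))
      ext j
      · simp only [D, Prod.fst_add, Pi.add_apply, smul_add, Finset.sum_add_distrib]
        rw [Fintype.sum_eq_single (a := k) (f := fun i => (ρ i : ℕ) •
          (Pi.single k d.1 : Fin m → V) i) fun i hi => by simp [hi]]
        simp [hk1]
        abel
      · simp only [D, Prod.snd_add, Pi.add_apply, smul_add, Finset.sum_add_distrib]
        rw [Fintype.sum_eq_single (a := k) (f := fun i => (ρ i : ℕ) •
          (Pi.single k d.2 : Fin m → Fin m → V) i j) fun i hi => by simp [hi]]
        simp [hk1]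
        abel
  obtain ⟨p, hp⟩ := exists_not_of_sum_expect_ind_lt_one
    (Finset.univ : Finset ((Fin m → Fin 2) ⊕ (Fin m → Fin 2)))
    (Sum.elim (fun ω p => h' (cubeVertex c ω) - h (cubeVertex c ω) +
      cubeSum h (cubeVertex c ω, W p ω) ≠ 0) fun ρ p => ρ ≠ 0 ∧ cubeSum h (D p ρ) ≠ 0) (by
      rw [Fintype.sum_sum_type]
      simp only [Sum.elim_inl, Sum.elim_inr]
      have h1 := Finset.sum_le_sum fun ω (_ : ω ∈ Finset.univ) => hω ω
      have h2 := Finset.sum_le_sum fun ρ (_ : ρ ∈ Finset.univ) => hρ ρ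
      simp only [Finset.sum_const, Finset.card_univ, Fintype.card_pi_const, Fintype.card_fin,
        nsmul_eq_mul, Nat.cast_pow, Nat.cast_ofNat] at h1 h2
      linarith)
  have h1 : ∀ ω, h' (cubeVertex c ω) - h (cubeVertex c ω) +
      cubeSum h (cubeVertex c ω, W p ω) = 0 := fun ω =>
    not_not.1 (hp (Sum.inl ω) (Finset.mem_univ _))
  have h2 : ∀ ρ, ρ ≠ 0 → cubeSum h (D p ρ) = 0 := fun ρ hρ => by
    by_contra hc
    exact hp (Sum.inr ρ) (Finset.mem_univ _) ⟨hρ, hc⟩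
  have h3 : altSum (fun ω => cubeSum h (cubeVertex c ω, W p ω)) = cubeSum h c := by
    have := altSum_altSum (fun ω ρ => h (cubeVertex (D p ρ) ω)) h2
    simp only [cubeSum, hswap]
    rw [this]
    simp [D]
  have h4 : altSum (fun ω => h' (cubeVertex c ω) - h (cubeVertex c ω) +
      cubeSum h (cubeVertex c ω, W p ω)) = 0 := by simp [h1, altSum]
  rw [altSum_add, altSum_sub, h3] at h4
  simpa [cubeSum] using h4

end SelfCorrection

/-! ### From a sparse uniform set to the whole space -/

section Sparse

variable {V H : Type*} [AddCommGroup V] [AddCommGroup H] {m : ℕ}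

/-- The cube `c` has its vertices in `X` and `F` has nonzero alternating sum on it. -/
def BadCube (X : Set V) (F : V → H) (c : V × (Fin m → V)) : Prop :=
  (∀ ω, cubeVertex c ω ∈ X) ∧ cubeSum F c ≠ 0

/-- The vertices of the cube `c` other than the base point are in `X`. -/
def PuncturedIn (X : Set V) (c : V × (Fin m → V)) : Prop :=
  ∀ ω, ω ≠ 0 → cubeVertex c ω ∈ X

lemma PuncturedIn.gridPt_mem {J : Type*} [DecidableEq J] {X : Set V} {z : Fin m → J → V}
    {a b σ : Fin m → J} (h : PuncturedIn X (boxCube z a b)) (hσ : σ ∈ puncturedBoxPts a b) :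
    gridPt z σ ∈ X := by
  obtain ⟨ω, hω, rfl⟩ := Finset.mem_image.1 hσ
  rw [← cubeVertex_boxCube]
  exact h ω (Finset.ne_of_mem_erase hω)

variable [Fintype V]

/-- Lets the uniformity error be absorbed at the density of two punctured cubes. -/
lemma two_mul_le_four_pow (m : ℕ) : 2 * (2 ^ m - 1) ≤ 4 ^ m := by
  have h : (4 : ℕ) ^ m = 2 ^ m * 2 ^ m := by rw [← mul_pow]; norm_num
  rcases Nat.eq_zero_or_pos m with rfl | hm
  · simp
  · have : 2 ≤ 2 ^ m := Nat.le_self_pow hm.ne' 2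
    rw [h]
    have := Nat.mul_le_mul_right (2 ^ m) this
    omega

/-- Two cubes with the same base point and other vertices in `X` mostly have the same alternating
sum. The cubes are joined by changing one edge at a time to that of a third cube. -/
lemma expect_cubeSum_ne_in_le (hm : 1 ≤ m) {X : Set V} {δ η ε κ : ℝ} (hδ0 : 0 < δ) (hδ1 : δ ≤ 1)
    (hη : 0 ≤ η) (hX : BoxUniform m X δ η) (hκ : 0 ≤ κ) (hηK : η ≤ ε * δ ^ 4 ^ m) (F : V → H)
    (hF : 𝔼 c : V × (Fin m → V), ind (BadCube X F c) ≤ κ * δ ^ 2 ^ m) :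
    𝔼 z : Fin m → Fin 4 → V, ind (PuncturedIn X (boxCube z (fun _ => 0) fun _ => 1) ∧
      PuncturedIn X (boxCube z (fun _ => 0) fun _ => 2) ∧
      cubeSum F (boxCube z (fun _ => 0) fun _ => 1) ≠
        cubeSum F (boxCube z (fun _ => 0) fun _ => 2)) ≤
      (2 * m * κ + (2 * m + 1) * (4 ^ m * ε)) * δ ^ (2 * (2 ^ m - 1)) := by
  classical
  let o : Fin 4 → Fin m → Fin 4 := fun j _ => j
  -- Option `0` is the common base, `1` and `2` are the two given cubes, `3` is the auxiliary cube.
  -- `E` contains every vertex of every link, and `T` consists of the vertices already known to be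
  -- in `X`. Points of `E \ T` use option `3`, of which the event to be bounded is independent.
  let E : Finset (Fin m → Fin 4) := Finset.univ.filter fun σ =>
    σ ≠ o 0 ∧ ((∀ i, σ i ≠ 1) ∨ ∀ i, σ i ≠ 2)
  let T : Finset (Fin m → Fin 4) := puncturedBoxPts (o 0) (o 1) ∪ puncturedBoxPts (o 0) (o 2)
  have hdisj : Disjoint (puncturedBoxPts (o 0) (o 1)) (puncturedBoxPts (o 0) (o 2)) := by
    rw [Finset.disjoint_left]
    intro σ h1 h2
    obtain ⟨ω, hω, rfl⟩ := Finset.mem_image.1 h1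
    obtain ⟨ω', -, h⟩ := Finset.mem_image.1 h2
    obtain ⟨i, hi⟩ := Function.ne_iff.1 (Finset.ne_of_mem_erase hω)
    have hi' : ω i ≠ 0 := hi
    have := congrFun h i
    simp only [pick, o, hi', if_false] at this
    split_ifs at this <;> simp at this
  have hTcard : T.card = 2 * (2 ^ m - 1) := by
    rw [Finset.card_union_of_disjoint hdisj, card_puncturedBoxPts fun i => by simp [o],
      card_puncturedBoxPts fun i => by simp [o], two_mul]
  have hmemT : ∀ q : Fin 4, ∀ σ : Fin m → Fin 4, σ ≠ o 0 → (∀ i, σ i = 0 ∨ σ i = q) →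
      σ ∈ puncturedBoxPts (o 0) (o q) := by
    intro q σ hσ h
    obtain ⟨ω, rfl⟩ := exists_pick_eq (a := o 0) (b := o q) h
    refine Finset.mem_image.2 ⟨ω, Finset.mem_erase.2 ⟨?_, Finset.mem_univ _⟩, rfl⟩
    rintro rfl
    exact hσ (pick_zero _ _)
  have hfour : ∀ j : Fin 4, j = 0 ∨ j = 1 ∨ j = 2 ∨ j = 3 := by decide
  have hS : ∀ σ ∈ E \ T, ∃ i, σ i = 3 := by
    intro σ hσ
    by_contra! hc
    obtain ⟨hE, hT⟩ := Finset.mem_sdiff.1 hσ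
    obtain ⟨-, h0, h12⟩ := Finset.mem_filter.1 hE
    apply hT
    rcases h12 with h1 | h2
    · refine Finset.mem_union_right _ (hmemT 2 σ h0 fun i => ?_)
      have := hfour (σ i); have := h1 i; have := hc i; tauto
    · refine Finset.mem_union_left _ (hmemT 1 σ h0 fun i => ?_)
      have := hfour (σ i); have := h2 i; have := hc i; tauto
  let s : Finset (Fin 4 × Fin m) := {1, 2} ×ˢ Finset.univ
  have hscard : s.card = 2 * m := by simp [s, Finset.card_product]
  let a : Fin 4 × Fin m → Fin m → Fin 4 := fun l => Function.update (o 0) l.2 3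
  let b : Fin 4 × Fin m → Fin m → Fin 4 := fun l i =>
    if i < l.2 then 3 else if l.1 = 1 then 1 else 2
  have hab : ∀ l i, a l i ≠ b l i := by
    intro l i
    by_cases hi : i = l.2
    · subst hi
      simp only [a, b, Function.update_self, lt_irrefl, if_false]
      split_ifs <;> decide
    · simp only [a, b, Function.update_of_ne hi, o]
      split_ifs <;> decide
  have hcardE : E.card ≤ 4 ^ m := (Finset.card_le_univ _).trans (by simp)
  have main := expect_ind_le_of_cover hm hδ0 hδ1 hη hX hκ (K := 4 ^ m) hηK E (E \ T) hcardE
    (fun z : Fin m → Fin 4 → V => PuncturedIn X (boxCube z (o 0) (o 1)) ∧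
      PuncturedIn X (boxCube z (o 0) (o 2)) ∧
      cubeSum F (boxCube z (o 0) (o 1)) ≠ cubeSum F (boxCube z (o 0) (o 2)))
    (fun σ hσ => by
      obtain ⟨i, hi⟩ := hS σ hσ
      refine ⟨i, freeAt_boxCube_pair (fun c c' => PuncturedIn X c ∧ PuncturedIn X c' ∧
        cubeSum F c ≠ cubeSum F c') ?_ ?_ ?_⟩ <;> rw [hi] <;> simp [o])
    s a b hab (fun _ => BadCube X F) (fun _ => 2 ^ m)
    (fun l _ => (Finset.card_le_card Finset.inter_subset_right).trans (card_boxPts_le _ _))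
    (fun _ _ => hF) (fun z hz hzS => by
      obtain ⟨h1, h2, hne⟩ := hz
      have hEX : ∀ σ ∈ E, gridPt z σ ∈ X := by
        intro σ hσ
        by_cases hT : σ ∈ T
        · rcases Finset.mem_union.1 hT with h | h
          · exact h1.gridPt_mem h
          · exact h2.gridPt_mem h
        · exact hzS σ (Finset.mem_sdiff.2 ⟨hσ, hT⟩)
      have hlink : ∃ l ∈ s, cubeSum F (boxCube z (a l) (b l)) ≠ 0 := by
        by_contra! hc
        apply hne
        simp only [cubeSum_boxCube] at hc ⊢
        rw [altSum_eq_of_links (fun σ => F (gridPt z σ)) (o 0) 1 3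
          (fun k => hc (1, k) (by simp [s])), altSum_eq_of_links (fun σ => F (gridPt z σ)) (o 0) 2 3
          (fun k => hc (2, k) (by simp [s]))]
      obtain ⟨l, hl, hlne⟩ := hlink
      refine ⟨l, hl, ⟨fun ω => ?_, hlne⟩, fun σ hσ => hEX σ (Finset.mem_sdiff.1 hσ).1⟩
      rw [cubeVertex_boxCube]
      -- In its own direction a link uses only options `3` and `1` or `2`, so it avoids the base
      -- point, which need not be in `X`.
      refine hEX _ (Finset.mem_filter.2 ⟨Finset.mem_univ _, fun h0 => ?_, ?_⟩)
      · have := congrFun h0 l.2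
        simp only [pick, a, b, o, Function.update_self, lt_irrefl, if_false] at this
        split_ifs at this <;> exact absurd this (by decide)
      · by_cases hl1 : l.1 = 1
        · refine Or.inr fun i => ?_
          by_cases hi : i = l.2
          · subst hi
            simp only [pick, a, b, Function.update_self, lt_irrefl, if_false, hl1, if_true]
            split_ifs <;> decide
          · simp only [pick, a, b, o, Function.update_of_ne hi, hl1, if_true]
            split_ifs <;> decide
        · refine Or.inl fun i => ?_
          by_cases hi : i = l.2
          · subst hi
            simp only [pick, a, b, Function.update_self, lt_irrefl, if_false, hl1]
            split_ifs <;> decide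
          · simp only [pick, a, b, o, Function.update_of_ne hi, hl1, if_false]
            split_ifs <;> decide)
    (2 * (2 ^ m - 1)) (by
      have hTE : T ⊆ E := by
        intro σ hσ
        have hq : ∀ q : Fin 4, q ≠ 0 → (q ≠ 1 ∨ q ≠ 2) → σ ∈ puncturedBoxPts (o 0) (o q) →
            σ ∈ E := by
          intro q hq0 hq12 h
          obtain ⟨ω, hω, rfl⟩ := Finset.mem_image.1 h
          refine Finset.mem_filter.2 ⟨Finset.mem_univ _, fun h0 => ?_, ?_⟩
          · obtain ⟨i, hi⟩ := Function.ne_iff.1 (Finset.ne_of_mem_erase hω)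
            have hi' : ω i ≠ 0 := hi
            have := congrFun h0 i
            simp only [pick, o, hi', if_false] at this
            exact hq0 this
          · refine hq12.imp (fun h i => ?_) fun h i => ?_
            · simp only [pick, o]
              split_ifs
              · decide
              · exact h
            · simp only [pick, o]
              split_ifs
              · decide
              · exact h
        rcases Finset.mem_union.1 hσ with h | h
        · exact hq 1 (by decide) (by decide) h
        · exact hq 2 (by decide) (by decide) h
      have := Finset.card_sdiff_add_card_eq_card hTE
      omega)
  rw [hscard] at main
  push_cast at main
  exact main

/-- Any function on `X` which has zero alternating sum on most cubes in `X` extends to a function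
on the whole space which has zero alternating sum on most cubes with vertices other than the base
point in `X`. -/
lemma exists_extension (hm : 1 ≤ m) {X : Set V} {δ η ε κ : ℝ} (hδ0 : 0 < δ) (hδ1 : δ ≤ 1)
    (hη : 0 ≤ η) (hX : BoxUniform m X δ η) (hκ : 0 ≤ κ) (hηK : η ≤ ε * δ ^ 4 ^ m) (F : V → H)
    (hF : 𝔼 c : V × (Fin m → V), ind (BadCube X F c) ≤ κ * δ ^ 2 ^ m) :
    ∃ h : V → H, (∀ x ∈ X, h x = F x) ∧
      𝔼 c : V × (Fin m → V), ind (PuncturedIn X c ∧ cubeSum h c ≠ 0) ≤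
        ((2 * m + 1) * κ + (2 * m + 2) * (4 ^ m * ε)) * δ ^ (2 ^ m - 1) := by
  classical
  let p : V → (Fin m → V) → (Fin m → V) → ℝ := fun x v v' =>
    ind (PuncturedIn X (x, v) ∧ PuncturedIn X (x, v') ∧ cubeSum F (x, v) ≠ cubeSum F (x, v'))
  -- Take for `u` the admissible cube at `x` with the least disagreement: it is beaten by no
  -- admissible `v'`. If there is no admissible cube, both sides vanish and any `u` serves.
  have hex : ∀ x, ∃ u : Fin m → V, 𝔼 v : Fin m → V, 𝔼 v' : Fin m → V,
      ind ((PuncturedIn X (x, v) ∧ cubeSum F (x, v) ≠ cubeSum F (x, u)) ∧ PuncturedIn X (x, v')) ≤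
        𝔼 v, 𝔼 v', p x v v' := by
    intro x
    let q : (Fin m → V) → ℝ := fun u =>
      𝔼 v : Fin m → V, ind (PuncturedIn X (x, v) ∧ cubeSum F (x, v) ≠ cubeSum F (x, u))
    rcases (Finset.univ.filter fun v : Fin m → V => PuncturedIn X (x, v)).eq_empty_or_nonempty
      with hemp | hne
    · have hno : ∀ v : Fin m → V, ¬PuncturedIn X (x, v) := fun v hv => by
        have : v ∈ (∅ : Finset (Fin m → V)) := hemp ▸ Finset.mem_filter.2 ⟨Finset.mem_univ _, hv⟩
        simp at this
      refine ⟨0, le_of_eq ?_⟩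
      simp [p, hno]
    · obtain ⟨u, -, hu⟩ := Finset.exists_min_image _ q hne
      refine ⟨u, ?_⟩
      rw [Finset.expect_comm, Finset.expect_comm (f := p x)]
      refine expect_mono fun v' => ?_
      by_cases hv' : PuncturedIn X (x, v')
      · have := hu v' (Finset.mem_filter.2 ⟨Finset.mem_univ _, hv'⟩)
        simpa only [p, hv', and_true, true_and] using this
      · simp only [p, hv', and_false, false_and]
        exact le_rfl
  choose u hu using hex
  -- Off `X` this is the value predicted by the chosen cube; when the other vertices of that cube
  -- lie in `X`, the term `F x` cancels.
  let h : V → H := fun x => if x ∈ X then F x else F x - cubeSum F (x, u x)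
  have hhX : ∀ x ∈ X, h x = F x := fun x hx => if_pos hx
  let Q : V × (Fin m → V) → Prop := fun c =>
    PuncturedIn X c ∧ cubeSum F c ≠ cubeSum F (c.1, u c.1)
  refine ⟨h, hhX, ?_⟩
  have hsplit : ∀ c : V × (Fin m → V), ind (PuncturedIn X c ∧ cubeSum h c ≠ 0) ≤
      ind (BadCube X F c) + ind (Q c) := by
    intro c
    by_cases hc : PuncturedIn X c ∧ cubeSum h c ≠ 0
    · obtain ⟨hcX, hne⟩ := hc
      have hd : cubeSum h c - cubeSum F c = h c.1 - F c.1 := by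
        have := altSum_sub_of_eq (fun ω => h (cubeVertex c ω)) (fun ω => F (cubeVertex c ω))
          fun ω hω => hhX _ (hcX ω hω)
        rwa [cubeVertex_zero] at this
      by_cases hx : c.1 ∈ X
      · have : BadCube X F c := by
          refine ⟨fun ω => ?_, ?_⟩
          · by_cases hω : ω = 0
            · rw [hω, cubeVertex_zero]; exact hx
            · exact hcX ω hω
          · rw [hhX _ hx, sub_self, sub_eq_zero] at hd
            rwa [← hd]
        rw [ind_of this]
        exact (ind_le_one _).trans (le_add_of_nonneg_right (ind_nonneg _))
      · have : Q c := by
          refine ⟨hcX, fun hc => hne ?_⟩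
          have hx' : h c.1 = F c.1 - cubeSum F (c.1, u c.1) := if_neg hx
          rw [hx', ← hc, sub_eq_iff_eq_add] at hd
          rw [hd]; abel
        rw [ind_of this]
        exact (ind_le_one _).trans (le_add_of_nonneg_left (ind_nonneg _))
    · rw [ind_of_not hc]
      exact add_nonneg (ind_nonneg _) (ind_nonneg _)
  let o : Fin 4 → Fin m → Fin 4 := fun j _ => j
  have h1 := expect_cubeSum_ne_in_le hm hδ0 hδ1 hη hX hκ hηK F hF
  rw [expect_boxCube_pair hm (fun _ => by decide) (fun _ => by decide) (fun _ => by decide)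
    fun c c' => ind (PuncturedIn X c ∧ PuncturedIn X c' ∧ cubeSum F c ≠ cubeSum F c')] at h1
  set κ₁ := 2 * m * κ + (2 * m + 1) * (4 ^ m * ε)
  -- As `u` depends only on the base point, `Q` is an event on the first cube. The second cube is
  -- thus an independent punctured cube, whose factor `δ ^ (2 ^ m - 1)` is divided out in `h5`.
  have h2 := (abs_le.1 (abs_expect_ind_sub_le hm hδ0.le hδ1 hη hX
    (fun z : Fin m → Fin 4 → V => Q (boxCube z (o 0) (o 1))) (puncturedBoxPts (o 0) (o 2))
    fun σ hσ => by
      obtain ⟨ω, hω, rfl⟩ := Finset.mem_image.1 hσ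
      obtain ⟨i, hi⟩ := Function.ne_iff.1 (Finset.ne_of_mem_erase hω)
      have hi' : ω i ≠ 0 := hi
      refine ⟨i, freeAt_boxCube Q ?_ ?_⟩ <;> simp [pick, o, hi'])).1
  have h3 : 𝔼 z : Fin m → Fin 4 → V, ind (Q (boxCube z (o 0) (o 1)) ∧
      ∀ σ ∈ puncturedBoxPts (o 0) (o 2), gridPt z σ ∈ X) ≤ κ₁ * δ ^ (2 * (2 ^ m - 1)) := by
    refine le_trans ?_ (le_trans (expect_mono hu) h1)
    rw [← expect_boxCube_pair (J := Fin 4) hm (a := o 0) (b := o 1) (b' := o 2)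
      (fun _ => by simp [o]) (fun _ => by simp [o]) (fun _ => by simp [o])
      fun c c' => ind ((PuncturedIn X c ∧ cubeSum F c ≠ cubeSum F (c.1, u c.1)) ∧
        PuncturedIn X c')]
    refine expect_mono fun z => ind_mono fun hz => ⟨hz.1, fun ω hω => ?_⟩
    rw [cubeVertex_boxCube]
    exact hz.2 _ (Finset.mem_image.2 ⟨ω, Finset.mem_erase.2 ⟨hω, Finset.mem_univ _⟩, rfl⟩)
  rw [expect_boxCube hm (fun _ => by simp [o]) fun c => ind (Q c),
    card_puncturedBoxPts fun i => by simp [o]] at h2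
  have hpow : ∀ {i j : ℕ}, i ≤ j → δ ^ j ≤ δ ^ i := fun h =>
    pow_le_pow_of_le_one hδ0.le hδ1 h
  have hε : 0 ≤ ε := by
    by_contra! h
    exact absurd (hη.trans hηK) (not_le.2 (mul_neg_of_neg_of_pos h (by positivity)))
  have hM := two_mul_le_four_pow m
  have h4 : ((2 ^ m - 1 : ℕ) : ℝ) * η ≤ 4 ^ m * ε * δ ^ (2 * (2 ^ m - 1)) := by
    have hc : ((2 ^ m - 1 : ℕ) : ℝ) ≤ 4 ^ m := by
      exact_mod_cast (by omega : 2 ^ m - 1 ≤ 4 ^ m)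
    calc ((2 ^ m - 1 : ℕ) : ℝ) * η ≤ 4 ^ m * (ε * δ ^ (2 * (2 ^ m - 1))) := by
          gcongr
          exact hηK.trans (mul_le_mul_of_nonneg_left (hpow hM) hε)
      _ = _ := by ring
  have h5 : 𝔼 c, ind (Q c) ≤ (κ₁ + 4 ^ m * ε) * δ ^ (2 ^ m - 1) := by
    have : δ ^ (2 ^ m - 1) * 𝔼 c, ind (Q c) ≤
        δ ^ (2 ^ m - 1) * ((κ₁ + 4 ^ m * ε) * δ ^ (2 ^ m - 1)) := by
      have : δ ^ (2 ^ m - 1) * ((κ₁ + 4 ^ m * ε) * δ ^ (2 ^ m - 1)) =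
          (κ₁ + 4 ^ m * ε) * δ ^ (2 * (2 ^ m - 1)) := by rw [two_mul, pow_add]; ring
      linarith
    exact le_of_mul_le_mul_left this (by positivity)
  calc _ ≤ 𝔼 c : V × (Fin m → V), (ind (BadCube X F c) + ind (Q c)) := expect_mono hsplit
    _ ≤ κ * δ ^ 2 ^ m + (κ₁ + 4 ^ m * ε) * δ ^ (2 ^ m - 1) := by
        rw [Finset.expect_add_distrib]; exact add_le_add hF h5
    _ ≤ κ * δ ^ (2 ^ m - 1) + (κ₁ + 4 ^ m * ε) * δ ^ (2 ^ m - 1) := by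
        have := mul_le_mul_of_nonneg_left (hpow (Nat.sub_le (2 ^ m) 1)) hκ
        linarith
    _ = _ := by simp only [κ₁]; ring

/-- If the alternating sum of `h` vanishes on most cubes whose vertices other than the base point
are in `X`, then it vanishes on most cubes, and also on most cubes with base point in `X`. -/
lemma expect_cubeSum_ne_zero_le (hm : 1 ≤ m) {X : Set V} {δ η ε κ : ℝ} (hδ0 : 0 < δ)
    (hδ1 : δ ≤ 1) (hη : 0 ≤ η) (hX : BoxUniform m X δ η) (hκ : 0 ≤ κ)
    (hηK : η ≤ ε * δ ^ 4 ^ m) (h : V → H)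
    (hbad : 𝔼 c : V × (Fin m → V), ind (BadCube X h c) ≤ κ * δ ^ 2 ^ m)
    (hpun : 𝔼 c : V × (Fin m → V), ind (PuncturedIn X c ∧ cubeSum h c ≠ 0) ≤
      κ * δ ^ (2 ^ m - 1)) (base : Bool) :
    𝔼 c : V × (Fin m → V), ind ((base = true → c.1 ∈ X) ∧ cubeSum h c ≠ 0) ≤
      (2 * 2 ^ m * κ + (2 * 2 ^ m + 1) * (4 ^ m * ε)) * δ ^ base.toNat := by
  classical
  -- An array of `4 ^ m` points: `ρ = 0` is the cube under study and each `ω` has a cube growing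
  -- from its vertex. The auxiliary points `S`, those with `ρ ≠ 0`, are put in `X`. If all the
  -- growing cubes and all the cubes with `ρ ≠ 0` have zero alternating sum, so does the cube `ρ =
  -- 0`.
  let pr : (Fin m → Fin 2) → (Fin m → Fin 2) → Fin m → Fin 2 × Fin 2 := fun ω ρ i => (ω i, ρ i)
  let S : Finset (Fin m → Fin 2 × Fin 2) := Finset.univ.filter fun σ => ∃ i, (σ i).2 ≠ 0
  let B : Finset (Fin m → Fin 2 × Fin 2) := if base = true then {pr 0 0} else ∅
  have hpick1 : ∀ ρ ω, pick (pr 0 ρ) (pr 1 ρ) ω = pr ω ρ := by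
    intro ρ ω
    funext i
    simp only [pick, pr]
    generalize ω i = w
    fin_cases w <;> rfl
  have hpick2 : ∀ ω ρ, pick (pr ω 0) (pr ω 1) ρ = pr ω ρ := by
    intro ω ρ
    funext i
    simp only [pick, pr]
    generalize ρ i = w
    fin_cases w <;> rfl
  have hBS : ∀ σ ∈ B, σ = pr 0 0 ∧ base = true := by
    intro σ hσ
    simp only [B] at hσ
    split_ifs at hσ with hb
    · exact ⟨Finset.mem_singleton.1 hσ, hb⟩
    · simp at hσ
  have hprS : ∀ ω ρ, ρ ≠ 0 → pr ω ρ ∈ S := by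
    intro ω ρ hρ
    obtain ⟨i, hi⟩ := Function.ne_iff.1 hρ
    exact Finset.mem_filter.2 ⟨Finset.mem_univ _, i, hi⟩
  have hprS0 : ∀ ω, pr ω 0 ∉ S := by
    intro ω hω
    obtain ⟨-, i, hi⟩ := Finset.mem_filter.1 hω
    exact hi rfl
  have hdisj : Disjoint S B := Finset.disjoint_left.2 fun σ h1 h2 =>
    hprS0 0 ((hBS σ h2).1 ▸ h1)
  have hBcard : B.card = base.toNat := by cases base <;> simp [B]
  let E := S ∪ B
  have hcardE : E.card ≤ 4 ^ m := (Finset.card_le_univ _).trans (by simp)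
  let a : (Fin m → Fin 2) ⊕ (Fin m → Fin 2) → Fin m → Fin 2 × Fin 2 :=
    Sum.elim (fun ρ => pr 0 ρ) fun ω => pr ω 0
  let b : (Fin m → Fin 2) ⊕ (Fin m → Fin 2) → Fin m → Fin 2 × Fin 2 :=
    Sum.elim (fun ρ => pr 1 ρ) fun ω => pr ω 1
  let Q : (Fin m → Fin 2) ⊕ (Fin m → Fin 2) → V × (Fin m → V) → Prop :=
    Sum.elim (fun ρ c => ρ ≠ 0 ∧ BadCube X h c) fun ω c =>
      (PuncturedIn X c ∧ cubeSum h c ≠ 0) ∧ (base = true ∧ ω = 0 → c.1 ∈ X)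
  -- A growing cube has its base point outside `E`, hence `2 ^ m - 1`, unless it starts at the base
  -- point of the studied cube and that point is required to be in `X`.
  let t : (Fin m → Fin 2) ⊕ (Fin m → Fin 2) → ℕ :=
    Sum.elim (fun _ => 2 ^ m) fun ω => if base = true ∧ ω = 0 then 2 ^ m else 2 ^ m - 1
  have main := expect_ind_le_of_cover hm hδ0 hδ1 hη hX hκ (K := 4 ^ m) hηK E S hcardE
    (fun z : Fin m → Fin 2 × Fin 2 → V =>
      (base = true → (boxCube z (pr 0 0) (pr 1 0)).1 ∈ X) ∧
        cubeSum h (boxCube z (pr 0 0) (pr 1 0)) ≠ 0)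
    (fun σ hσ => by
      obtain ⟨-, i, hi⟩ := Finset.mem_filter.1 hσ
      refine ⟨i, freeAt_boxCube (fun c => (base = true → c.1 ∈ X) ∧ cubeSum h c ≠ 0) ?_ ?_⟩ <;>
      exact fun hc => hi (congrArg Prod.snd hc).symm)
    Finset.univ a b
    (by
      rintro (ρ | ω) i
      · simp [a, b, pr]
      · simp [a, b, pr])
    Q t
    (by
      rintro (ρ | ω) -
      · exact (Finset.card_le_card Finset.inter_subset_right).trans (card_boxPts_le _ _)
      · by_cases hc : base = true ∧ ω = 0
        · simp only [t, Sum.elim_inr, if_pos hc]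
          exact (Finset.card_le_card Finset.inter_subset_right).trans (card_boxPts_le _ _)
        · simp only [t, Sum.elim_inr, if_neg hc, a, b]
          refine (Finset.card_le_card fun σ hσ => ?_).trans
            (card_puncturedBoxPts_le (pr ω 0) (pr ω 1))
          obtain ⟨hE, hb⟩ := Finset.mem_inter.1 hσ
          obtain ⟨ρ, -, rfl⟩ := Finset.mem_image.1 hb
          refine Finset.mem_image.2 ⟨ρ, Finset.mem_erase.2 ⟨?_, Finset.mem_univ _⟩, rfl⟩
          rintro rfl
          rw [hpick2] at hE
          rcases Finset.mem_union.1 hE with h1 | h1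
          · exact hprS0 ω h1
          · obtain ⟨h2, h3⟩ := hBS _ h1
            refine hc ⟨h3, funext fun i => ?_⟩
            exact congrArg Prod.fst (congrFun h2 i))
    (by
      rintro (ρ | ω) -
      · exact (expect_mono fun c => ind_mono And.right).trans hbad
      · by_cases hc : base = true ∧ ω = 0
        · simp only [t, Q, Sum.elim_inr, if_pos hc]
          refine (expect_mono fun c => ind_mono fun hcc => ?_).trans hbad
          refine ⟨fun ρ => ?_, hcc.1.2⟩
          by_cases hρ : ρ = 0
          · rw [hρ, cubeVertex_zero]; exact hcc.2 hc
          · exact hcc.1.1 ρ hρ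
        · simp only [t, Q, Sum.elim_inr, if_neg hc]
          exact (expect_mono fun c => ind_mono And.left).trans hpun)
    (fun z hz hzS => by
      obtain ⟨hbase, hne⟩ := hz
      have hbase' : base = true → gridPt z (pr 0 0) ∈ X := hbase
      have hEX : ∀ σ ∈ E, gridPt z σ ∈ X := by
        intro σ hσ
        rcases Finset.mem_union.1 hσ with h1 | h1
        · exact hzS σ h1
        · obtain ⟨rfl, h2⟩ := hBS σ h1
          exact hbase' h2
      have hex : ∃ l : (Fin m → Fin 2) ⊕ (Fin m → Fin 2), Q l (boxCube z (a l) (b l)) := by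
        by_contra! hc
        have hρ : ∀ ρ, ρ ≠ 0 → altSum (fun ω => h (gridPt z (pr ω ρ))) = 0 := by
          intro ρ hρ
          by_contra hn
          refine hc (Sum.inl ρ) ⟨hρ, fun ω => ?_, ?_⟩
          · simp only [a, b, Sum.elim_inl, cubeVertex_boxCube, hpick1]
            exact hzS _ (hprS ω ρ hρ)
          · simpa only [a, b, Sum.elim_inl, cubeSum_boxCube, hpick1] using hn
        have hω : ∀ ω, altSum (fun ρ => h (gridPt z (pr ω ρ))) = 0 := by
          intro ω
          by_contra hn
          refine hc (Sum.inr ω) ⟨⟨fun ρ hρ => ?_, ?_⟩, fun hb => ?_⟩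
          · simp only [a, b, Sum.elim_inr, cubeVertex_boxCube, hpick2]
            exact hzS _ (hprS ω ρ hρ)
          · simpa only [a, b, Sum.elim_inr, cubeSum_boxCube, hpick2] using hn
          · obtain ⟨hb1, rfl⟩ := hb
            exact hbase' hb1
        apply hne
        have := altSum_altSum (fun ω ρ => h (gridPt z (pr ω ρ))) hρ
        simp only [cubeSum_boxCube, hpick1]
        rw [← this]
        simp_rw [hω]
        simp [altSum]
      obtain ⟨l, hl⟩ := hex
      exact ⟨l, Finset.mem_univ _, hl, fun σ hσ => hEX σ (Finset.mem_sdiff.1 hσ).1⟩)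
    base.toNat (by rw [Finset.card_union_of_disjoint hdisj, hBcard])
  rw [expect_boxCube hm (fun i => by simp [pr])
    fun c => ind ((base = true → c.1 ∈ X) ∧ cubeSum h c ≠ 0)] at main
  have hcard : ((Finset.univ : Finset ((Fin m → Fin 2) ⊕ (Fin m → Fin 2))).card : ℝ) =
      2 * 2 ^ m := by
    simp [Fintype.card_sum]; ring
  rw [hcard] at main
  push_cast at main
  exact main

end Sparse

/-! ### Approximately polynomial functions on uniform sets -/

lemma expect_ind_eq_card_div {A : Type*} [Fintype A] (p : A → Prop) :
    𝔼 a, ind (p a) = (Nat.card {a // p a} : ℝ) / Nat.card A :=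
  expect_ind_mem {a | p a}

lemma card_inter_add_card_diff {A : Type*} [Fintype A] (Y : Set A) (P : A → Prop) :
    (Nat.card {y : Y // P y} : ℝ) + Nat.card {a // a ∈ Y ∧ ¬P a} = Nat.card Y := by
  classical
  have h1 : Nat.card {y : Y // P y} = Nat.card {y : A // y ∈ Y ∧ P y} :=
    Nat.card_congr (Equiv.subtypeSubtypeEquivSubtypeInter (· ∈ Y) P)
  rw [h1]
  have h2 : Nat.card Y = Nat.card {a // a ∈ Y} := rfl
  rw [h2]
  simp only [Nat.card_eq_fintype_card, Fintype.card_subtype]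
  norm_cast
  rw [← Finset.card_filter_add_card_filter_not (s := Finset.univ.filter (· ∈ Y)) P,
    Finset.filter_filter, Finset.filter_filter]

/-- Turns proportions of `Y` into averages over the ambient type, where the grid estimates live. -/
lemma holdsAE_iff {A : Type*} [Fintype A] [Nonempty A] (Y : Set A) (P : A → Prop) (ε : ℝ) :
    HoldsAE ε (fun y : Y => P y) ↔
      𝔼 a, ind (a ∈ Y ∧ ¬P a) ≤ ε * 𝔼 a, ind (a ∈ Y) := by
  have h := card_inter_add_card_diff Y P
  have hA : (0 : ℝ) < Nat.card A := by exact_mod_cast Nat.card_pos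
  rw [expect_ind_mem Y, expect_ind_eq_card_div, ← mul_div_assoc, div_le_div_iff_of_pos_right hA,
    HoldsAE]
  constructor <;> intro h' <;> linarith

/-- Converts an exceptional proportion of the cubes in `X` into a proportion of all cubes, at the
expected density `δ ^ 2 ^ m`. -/
lemma expect_mem_cubesIn_le {V : Type*} [AddCommGroup V] [Fintype V] {m : ℕ} (hm : 1 ≤ m)
    {X : Set V} {δ η : ℝ} (hδ0 : 0 < δ) (hδ1 : δ ≤ 1) (hη : 0 ≤ η) (hX : BoxUniform m X δ η)
    (hηδ : η ≤ δ ^ 4 ^ m) :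
    𝔼 c, ind (c ∈ cubesIn m X) ≤ (1 + 4 ^ m) * δ ^ 2 ^ m := by
  classical
  let o : Fin 2 → Fin m → Fin 2 := fun j _ => j
  have ho : ∀ i, o 0 i ≠ o 1 i := fun i => by simp [o]
  have hcard : (boxPts (o 0) (o 1)).card = 2 ^ m := by
    rw [boxPts, Finset.card_image_of_injective _ (pick_injective ho)]; simp
  have h1 := (abs_le.1 (abs_expect_ind_sub_le hm hδ0.le hδ1 hη hX
    (fun _ : Fin m → Fin 2 → V => True) (boxPts (o 0) (o 1))
    fun σ _ => ⟨⟨0, hm⟩, fun _ _ _ => Iff.rfl⟩)).2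
  have h2 : 𝔼 z : Fin m → Fin 2 → V, ind (True ∧ ∀ σ ∈ boxPts (o 0) (o 1), gridPt z σ ∈ X) =
      𝔼 c, ind (c ∈ cubesIn m X) := by
    rw [← expect_boxCube hm ho fun c => ind (c ∈ cubesIn m X)]
    refine Finset.expect_congr rfl fun z _ => congrArg ind (propext ?_)
    simp [boxPts, cubesIn, cubeVertex_boxCube]
  rw [h2, hcard] at h1
  simp only [ind_of trivial, Fintype.expect_const, mul_one] at h1
  have h24 : 2 ^ m ≤ 4 ^ m := Nat.pow_le_pow_left (by norm_num) m
  have h3 : ((2 ^ m : ℕ) : ℝ) * η ≤ 4 ^ m * δ ^ 2 ^ m := by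
    have : ((2 ^ m : ℕ) : ℝ) ≤ 4 ^ m := by exact_mod_cast h24
    gcongr
    exact hηδ.trans (pow_le_pow_of_le_one hδ0.le hδ1 h24)
  linarith

theorem theorem2 (m : ℕ) (hm : 1 ≤ m) :
    ∃ α B C : ℝ, 0 < α ∧ 0 < B ∧ 0 < C ∧
      ∀ (k V H : Type*) [Field k] [AddCommGroup V] [Module k V] [Fintype V] [AddCommGroup H]
        (δ ε η : ℝ), 0 < δ → 0 < ε → ε < α → η < (ε * δ) ^ B →
        ∀ X : Set V, (Nat.card X : ℝ) / (Nat.card V : ℝ) = δ → IsGowersUniform η m X →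
        ∀ f : X → H, HoldsAE ε (fun c : cubesIn m X => cubeSumOn f c = 0) →
          ∃ h : V → H, (∀ c : V × (Fin m → V), cubeSum h c = 0) ∧
            HoldsAE (C * ε) (fun x : X => h x = f x) := by
  classical
  -- `K` bounds the size of the configurations; `C₁` is the constant after extending to `V`, and
  -- `C₂` the one after passing to all cubes.
  let K : ℝ := 4 ^ m
  let C₁ : ℝ := (2 * m + 1) * (1 + K) + (2 * m + 2) * K
  let C₂ : ℝ := 2 * 2 ^ m * C₁ + (2 * 2 ^ m + 1) * K
  have hK : 1 ≤ K := one_le_pow₀ (by norm_num)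
  have hC₁ : 1 + K ≤ C₁ := by
    have h1 : (0 : ℝ) ≤ m * (1 + K) := by positivity
    have h2 : (0 : ℝ) ≤ (2 * m + 2) * K := by positivity
    simp only [C₁]
    linarith
  have hC₂ : 1 ≤ C₂ := by
    have h1 : (0 : ℝ) ≤ 2 * 2 ^ m * C₁ := mul_nonneg (by positivity) (by linarith)
    have h2 : (0 : ℝ) ≤ 2 * 2 ^ m * K := by positivity
    simp only [C₂]
    linarith
  have hm2 : (2 : ℝ) ≤ 2 ^ m := by exact_mod_cast Nat.le_self_pow (by omega : m ≠ 0) 2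
  -- The first constant makes the union bound of the self-correction less than `1`. The second gives
  -- `(ε * δ) ^ (4 ^ m + 1) ≤ ε * δ ^ 4 ^ m`, the uniformity that counting needs. The factor `2` in
  -- the third comes from the half of the cubes in `hpt`.
  refine ⟨1 / (2 ^ m * ((m + 1) * C₂)), 4 ^ m + 1, 2 * C₂, by positivity, by positivity,
    by positivity, ?_⟩
  intro k V H _ _ _ _ _ δ ε η hδ0 hε0 hεα hηB X hXδ hXu f hf
  rw [lt_div_iff₀ (by positivity)] at hεα
  have hεm : 2 ^ m * ((m + 1) * (C₂ * ε)) < 1 := by linarith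
  have hmC : 0 ≤ m * (C₂ * ε) := by positivity
  have hCε : 0 < C₂ * ε := by positivity
  have hεm2 : 2 * ((m + 1) * (C₂ * ε)) < 1 :=
    lt_of_le_of_lt (mul_le_mul_of_nonneg_right hm2 (by positivity)) hεm
  have hε1 : ε ≤ 1 := by
    have := mul_le_mul_of_nonneg_right hC₂ hε0.le
    linarith
  have hV : (0 : ℝ) < Nat.card V := by exact_mod_cast Nat.card_pos
  have hδ1 : δ ≤ 1 := by
    rw [← hXδ, div_le_one hV]
    exact_mod_cast Nat.card_le_card_of_injective _ Subtype.val_injective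
  obtain ⟨hη, hX⟩ := hXu.boxUniform hXδ
  have hηK : η ≤ ε * δ ^ 4 ^ m := by
    have h1 : (ε * δ) ^ ((4 : ℝ) ^ m + 1) = (ε * δ) ^ (4 ^ m + 1) := by
      exact_mod_cast Real.rpow_natCast (ε * δ) (4 ^ m + 1)
    rw [h1] at hηB
    refine hηB.le.trans ?_
    rw [mul_pow]
    exact mul_le_mul (pow_le_of_le_one hε0.le hε1 (Nat.succ_ne_zero _))
      (pow_le_pow_of_le_one hδ0.le hδ1 (Nat.le_succ _)) (by positivity) hε0.le
  -- The value off `X` is arbitrary: a bad cube for `F` has all its vertices in `X`.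
  let F : V → H := fun x => if hx : x ∈ X then f ⟨x, hx⟩ else 0
  have hFf : ∀ x : X, F x = f x := fun x => dif_pos x.2
  have hbadF : 𝔼 c : V × (Fin m → V), ind (BadCube X F c) ≤ ((1 + K) * ε) * δ ^ 2 ^ m := by
    have h1 : ∀ c : cubesIn m X, cubeSumOn f c = cubeSum F c.1 := by
      intro c
      simp only [cubeSumOn, cubeSum]
      congr 1
      funext ω
      exact (hFf ⟨_, c.2 ω⟩).symm
    simp_rw [h1] at hf
    have h2 := (holdsAE_iff (cubesIn m X) (fun c => cubeSum F c = 0) ε).1 hf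
    have h3 := expect_mem_cubesIn_le hm hδ0 hδ1 hη hX
      (hηK.trans (mul_le_of_le_one_left (by positivity) hε1))
    calc 𝔼 c : V × (Fin m → V), ind (BadCube X F c) ≤ ε * 𝔼 c, ind (c ∈ cubesIn m X) := h2
      _ ≤ ε * ((1 + K) * δ ^ 2 ^ m) := mul_le_mul_of_nonneg_left h3 hε0.le
      _ = _ := by ring
  obtain ⟨h, hhX, hpun⟩ := exists_extension hm hδ0 hδ1 hη hX (by positivity) hηK F hbadF
  have hpun' : 𝔼 c : V × (Fin m → V), ind (PuncturedIn X c ∧ cubeSum h c ≠ 0) ≤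
      (C₁ * ε) * δ ^ (2 ^ m - 1) := hpun.trans (le_of_eq (by simp only [C₁, K]; ring))
  have hbad : 𝔼 c : V × (Fin m → V), ind (BadCube X h c) ≤ (C₁ * ε) * δ ^ 2 ^ m := by
    refine le_trans (expect_mono fun c => ind_mono fun hc => ?_) (hbadF.trans ?_)
    · refine ⟨hc.1, ?_⟩
      have : cubeSum F c = cubeSum h c := by
        simp only [cubeSum]
        congr 1
        funext ω
        exact (hhX _ (hc.1 ω)).symm
      rw [this]
      exact hc.2
    · gcongr
  have hC₁0 : 0 ≤ C₁ * ε := mul_nonneg (by linarith) hε0.le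
  have hfin : ∀ base : Bool,
      𝔼 c : V × (Fin m → V), ind ((base = true → c.1 ∈ X) ∧ cubeSum h c ≠ 0) ≤
        (C₂ * ε) * δ ^ base.toNat := fun base =>
    (expect_cubeSum_ne_zero_le hm hδ0 hδ1 hη hX hC₁0 hηK h hbad hpun' base).trans
      (le_of_eq (by simp only [C₂, K]; ring))
  obtain ⟨h', hpoly, hmost⟩ := exists_polynomial_correction h
    (by simpa using hfin false) hεm
  refine ⟨h', hpoly, ?_⟩
  have hfF : (fun x : X => h' x = f x) = fun x : X => h' x = F x := by
    funext x; rw [hFf]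
  rw [hfF, holdsAE_iff X (fun x => h' x = F x), expect_ind_mem, hXδ]
  -- At every `x` more than half of the cubes predict `h' x`. If `h' x ≠ h x`, each of these has
  -- nonzero alternating sum for `h`.
  have hpt : ∀ x, ind (x ∈ X ∧ ¬h' x = F x) ≤
      2 * 𝔼 v : Fin m → V, ind (x ∈ X ∧ cubeSum h (x, v) ≠ 0) := by
    intro x
    by_cases hx : x ∈ X ∧ ¬h' x = F x
    · rw [ind_of hx]
      have h1 := expect_ind_add_expect_ind_not fun v : Fin m → V =>
        h' x - h x + cubeSum h (x, v) ≠ 0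
      have h2 : 𝔼 v : Fin m → V, ind (¬h' x - h x + cubeSum h (x, v) ≠ 0) ≤
          𝔼 v : Fin m → V, ind (x ∈ X ∧ cubeSum h (x, v) ≠ 0) := by
        refine expect_mono fun v => ind_mono fun hv => ⟨hx.1, fun h0 => hx.2 ?_⟩
        rw [not_not, h0, add_zero, sub_eq_zero] at hv
        rw [hv, hhX x hx.1]
      have h3 := hmost x
      linarith
    · rw [ind_of_not hx]
      exact mul_nonneg zero_le_two (expect_nonneg_of fun v => ind_nonneg _)
  -- Requiring the base point in `X` gains the factor `δ` that makes the final error a proportion of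
  -- `|X|` and not of `|V|`.
  have hX1 := hfin true
  rw [expect_prod_type] at hX1
  simp only [forall_const, Bool.toNat_true, pow_one] at hX1
  calc 𝔼 x, ind (x ∈ X ∧ ¬h' x = F x)
      ≤ 𝔼 x, 2 * 𝔼 v : Fin m → V, ind (x ∈ X ∧ cubeSum h (x, v) ≠ 0) := expect_mono hpt
    _ = 2 * 𝔼 x, 𝔼 v : Fin m → V, ind (x ∈ X ∧ cubeSum h (x, v) ≠ 0) :=
        (Finset.mul_expect _ _ _).symm
    _ ≤ 2 * (C₂ * ε * δ) := by gcongr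
    _ = 2 * C₂ * ε * δ := by ring
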